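/- Let $r\geq 0$, $W=S_r$ with simple reflections $s_i=(i,i+1)$ and length $\ell$. Let $R$ be an integral domain and $t\in R^\times$ (for instance $R=\mathbb{C}$, or $R=\mathbb{C}[t,t^{-1}]$ with $t$ an indeterminate). Let $\mathbf{z}=(z_1,\dots,z_r)$ be indeterminates, $\mathbf{z}^{\alpha_i}=z_i/z_{i+1}$, let $s_i$ act on functions of $\mathbf{z}$ by exchanging $z_i$ and $z_{i+1}$, and put $$\mathcal{L}_{i,t}f=\frac{f-s_if}{\mathbf{z}^{\alpha_i}-1}-t\,\frac{f-\mathbf{z}^{\alpha_i}s_if}{\mathbf{z}^{\alpha_i}-1},\qquad \mathcal{L}_{i,t}^{-1}f=\frac{f-s_if}{\mathbf{z}^{-\alpha_i}-1}-t^{-1}\,\frac{f-\mathbf{z}^{-\alpha_i}s_if}{\mathbf{z}^{-\alpha_i}-1},$$ and $\mathcal{L}_{w,t}=\mathcal{L}_{i_1,t}\cdots\mathcal{L}_{i_k,t}$ for any reduced expression $w=s_{i_1}\cdots s_{i_k}$. Let $\lambda=(\lambda_1\geq\dots\geq\lambda_r)\in\mathbb{Z}^r$ and let $M\leq N$ be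 integers with $M\leq\lambda_i\leq N$ for all $i$ (for a partition one may take $M=0$). Let $\gamma_1>\dots>\gamma_r$ be colors. For a permutation $w$ let $w\mathbf{c}_0$ be the flag whose $i$-th color is $\gamma_{w^{-1}(i)}$; these are the proper flags, i.e. the sequences of $r$ distinct colors. For proper flags $\mathbf{c},\mathbf{d}$ consider a grid with rows $1,\dots,r$ from top to bottom and columns labeled $N,N-1,\dots,M$ from left to right. Horizontal edges carry spins in $\{+,\gamma_1,\dots,\gamma_r\}$, vertical edges carry multisets of colors. The boundary spins are $+$ on the left, $d_i$ on the right of row $i$, the empty multiset at the bottom, and at the top of column $j$ the multiset in which $\gamma_k$ has multiplicity $\#\{i:\lambda_i=j,\ c_i=\gamma_k\}$. A vertex in row $i$ is the fusion of $r$ monochrome vertices of colors $\gamma_r,\dots,\gamma_1$ from left to right: its weight is the sum, over the spins of the $r-1$ intermediate horizontal edges, of the product of the monochrome weights, the $k$-th multiplicity of the top and bottom spin being attached to the vertex of color $\gamma_k$. The weight of the monochrome vertex of color $c$ in row $i$, with spins (left, top, right, bottom), is $$(+,n,+,n)\mapsto 1;\qquad (d,n,d,n)\mapsto 1,\ z_i,\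 t^n\ \text{ for } c<d,\ c=d,\ c>d \text{ respectively};$$ $$(c,n,+,n+1)\mapsto z_i(1-t^{n+1});\qquad (+,n+1,c,n)\mapsto 1$$ for the $P$-weights; for the $R$-weights the last two are replaced by $z_i(1-t)$ and $1+t+\dots+t^n$; all other weights are $0$. The weight of a state (an assignment of spins to all edges with the given boundary spins) is the product of the weights of its vertices, and $$Z(\mathfrak{S}_{\lambda,\mathbf{c},\mathbf{d}}(\mathbf{z};t))=(z_1\cdots z_r)^M\sum_{\text{states}}(\text{weight of the state}).$$ Theorem. For both the $P$- and the $R$-weights, for every admissible choice of $M,N$ and for all $w,y\in W$, only finitely many states have nonzero weight, and: (1) $Z(\mathfrak{S}_{\lambda,\mathbf{c}_0,w\mathbf{c}_0}(\mathbf{z};t))=\mathcal{L}_{w,t}\,\mathbf{z}^\lambda$, where $w$ has a reduced expression and any one of them may be used to compute $\mathcal{L}_{w,t}\,\mathbf{z}^\lambda$; (2) more generally, $Z(\mathfrak{S}_{\lambda,y\mathbf{c}_0,w\mathbf{c}_0}(\mathbf{z};t))=\tau^\lambda_{w,y}(\mathbf{z};t)$, where, for fixed $y$, $(\tau^\lambda_{w,y})_{w\in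 W}$ is the unique family in $R[z_1^{\pm1},\dots,z_r^{\pm1}]$ such that $\tau^\lambda_{y,y}=t^{\ell(y)}\mathbf{z}^\lambda$ and, for every $w$ and every simple reflection $s_i$, $\tau^\lambda_{s_iw,y}=\mathcal{L}_{i,t}\tau^\lambda_{w,y}$ if $s_iw>w$ and $\tau^\lambda_{s_iw,y}=\mathcal{L}_{i,t}^{-1}\tau^\lambda_{w,y}$ if $s_iw<w$. -/

import Mathlib

open scoped BigOperators

namespace ColoredBoson

/-! ### The symmetric group `W = S_r`, acting on `{0, …, r-1}` -/

/-- The index `i` of the simple reflection `s_i`, as an element of `Fin r`. -/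
def lo {r : ℕ} (i : Fin (r - 1)) : Fin r := ⟨i.1, by omega⟩

/-- The index `i + 1`, as an element of `Fin r`. -/
def hi {r : ℕ} (i : Fin (r - 1)) : Fin r := ⟨i.1 + 1, by omega⟩

/-- The simple reflection `s_i = (i, i+1)`. -/
def simpleRefl {r : ℕ} (i : Fin (r - 1)) : Equiv.Perm (Fin r) := Equiv.swap (lo i) (hi i)

/-- The length `ℓ(w)`: the number of inversions of `w`, that is, the number of positive roots
that `w` makes negative. -/
def len {r : ℕ} (w : Equiv.Perm (Fin r)) : ℕ :=
  (Finset.univ.filter fun p : Fin r × Fin r => p.1 < p.2 ∧ w p.2 < w p.1).card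

/-- `l = [i_1, …, i_k]` is a reduced word of `w`, i.e. `w = s_{i_1} ⋯ s_{i_k}` with `k = ℓ(w)`. -/
def IsReducedWord {r : ℕ} (w : Equiv.Perm (Fin r)) (l : List (Fin (r - 1))) : Prop :=
  (l.map simpleRefl).prod = w ∧ l.length = len w

/-! ### Laurent polynomials in `z_1, …, z_r` and Demazure-Lusztig operators

The base ring `R` is a domain. The parameter `t` is a unit of `R`: the case `R = ℂ` is that of a
nonzero complex parameter, and `R = ℂ[t, t⁻¹]` that of an indeterminate. Everything takes place in
the field of fractions of `R[z_1, …, z_r]`, which contains the ring `R[z_1^±, …, z_r^±]`. -/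

section Operators

variable (R : Type*) [CommRing R] [IsDomain R] (r : ℕ)

/-- The field of rational functions in `z_1, …, z_r`. -/
abbrev RatField : Type _ := FractionRing (MvPolynomial (Fin r) R)

variable {r}

/-- The variable `z_i`. -/
noncomputable def zvar (i : Fin r) : RatField R r :=
  algebraMap (MvPolynomial (Fin r) R) (RatField R r) (MvPolynomial.X i)

/-- The monomial `z^μ = ∏ z_i ^ μ_i`. -/
noncomputable def zmon (μ : Fin r → ℤ) : RatField R r := ∏ i, zvar R i ^ μ i

variable (r) in
/-- The ring `R[z_1^±, …, z_r^±]` of Laurent polynomials. -/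
noncomputable def laurent : Subalgebra R (RatField R r) :=
  Algebra.adjoin R (Set.range (zvar R) ∪ Set.range fun i : Fin r => (zvar R i)⁻¹)

/-- The substitution `z_j ↦ z_{σ(j)}`. -/
noncomputable def permVars (σ : Equiv.Perm (Fin r)) : RatField R r ≃+* RatField R r :=
  IsFractionRing.ringEquivOfRingEquiv (MvPolynomial.renameEquiv R σ).toRingEquiv

/-- `z^{α_i} = z_i / z_{i+1}`. -/
noncomputable def zroot (i : Fin (r - 1)) : RatField R r := zvar R (lo i) / zvar R (hi i)

variable {R}

/-- The parameter `t` as an element of the field of rational functions. -/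
noncomputable def param (r : ℕ) (t : Rˣ) : RatField R r := algebraMap R (RatField R r) t

/-- The Demazure-Lusztig operator `𝓛_{i,t}`. -/
noncomputable def demLus (t : Rˣ) (i : Fin (r - 1)) (f : RatField R r) : RatField R r :=
  (f - permVars R (simpleRefl i) f) / (zroot R i - 1)
    - param r t * ((f - zroot R i * permVars R (simpleRefl i) f) / (zroot R i - 1))

/-- The inverse operator `𝓛_{i,t}⁻¹`. -/
noncomputable def demLusInv (t : Rˣ) (i : Fin (r - 1)) (f : RatField R r) : RatField R r :=
  (f - permVars R (simpleRefl i) f) / ((zroot R i)⁻¹ - 1)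
    - (param r t)⁻¹ *
      ((f - (zroot R i)⁻¹ * permVars R (simpleRefl i) f) / ((zroot R i)⁻¹ - 1))

/-- `𝓛_{i_1,t} ⋯ 𝓛_{i_k,t}` for a word `[i_1, …, i_k]`; it is `𝓛_{w,t}` if the word is a reduced
word of `w`. -/
noncomputable def demLusWord (t : Rˣ) : List (Fin (r - 1)) → RatField R r → RatField R r
  | [], f => f
  | i :: l, f => demLus t i (demLusWord t l f)

/-- The conditions that characterize the family `(τ^μ_{w,y})_{w ∈ W}` for given `μ` and `y`. For a
simple reflection `s`, the relation `s w > w` of the Bruhat order means `ℓ(s w) > ℓ(w)`. -/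
structure IsTauFamily (t : Rˣ) (μ : Fin r → ℤ) (y : Equiv.Perm (Fin r))
    (τ : Equiv.Perm (Fin r) → RatField R r) : Prop where
  mem_laurent : ∀ w, τ w ∈ laurent R r
  base : τ y = param r t ^ len y * zmon R μ
  up : ∀ (i : Fin (r - 1)) (w : Equiv.Perm (Fin r)), len w < len (simpleRefl i * w) →
    τ (simpleRefl i * w) = demLus t i (τ w)
  down : ∀ (i : Fin (r - 1)) (w : Equiv.Perm (Fin r)), len (simpleRefl i * w) < len w →
    τ (simpleRefl i * w) = demLusInv t i (τ w)

end Operators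

/-! ### The colored bosonic models

The color `γ_{k+1}` is represented by `k : Fin r`. Since `γ_1 > ⋯ > γ_r`, a smaller index means a
larger color. Horizontal spins are elements of `Option (Fin r)`, with `none` for the vacuum color
`+`; vertical spins are multisets of colors, given by their multiplicities `Fin r → ℕ`. -/

/-- The two variants of the Boltzmann weights. -/
inductive WeightKind
  | P
  | R

section Model

variable {A : Type*} [CommRing A] {r : ℕ}

/-- Boltzmann weight of the monochrome vertex of type `(z, c)` with left spin `a`, top spin `n`,
right spin `b` and bottom spin `m`. The four nonzero cases are `A(n)`, `B(n)`, `C(n)`, `D(m)`;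
the weight `(1 - t^{m+1}) / (1 - t)` is written as `1 + t + ⋯ + t^m`. -/
def monoWeight (κ : WeightKind) (t z : A) (c : Fin r) (a : Option (Fin r)) (n : ℕ)
    (b : Option (Fin r)) (m : ℕ) : A :=
  match a, b with
  | none, none => if m = n then 1 else 0
  | some d, some e =>
      if d = e ∧ m = n then
        if d < c then 1 else if c = d then z else t ^ n
      else 0
  | some d, none =>
      if d = c ∧ m = n + 1 then
        match κ with
        | .P => z * (1 - t ^ (n + 1))
        | .R => z * (1 - t)
      else 0
  | none, some e =>
      if e = c ∧ n = m + 1 then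
        match κ with
        | .P => 1
        | .R => ∑ k ∈ Finset.range (m + 1), t ^ k
      else 0

/-- Boltzmann weight of the fused vertex with left, top, right and bottom spins `a, b, c, d`: the
partition function of a row of `r` monochrome vertices of colors `γ_r, …, γ_1` from left to right,
summed over the spins `g` of the horizontal edges with both ends fixed. -/
def fusedWeight (κ : WeightKind) (t z : A) (a : Option (Fin r)) (b : Fin r → ℕ)
    (c : Option (Fin r)) (d : Fin r → ℕ) : A :=
  ∑ g : Fin (r + 1) → Option (Fin r),
    if g 0 = a ∧ g (Fin.last r) = c then
      ∏ k : Fin r, monoWeight κ t z k.rev (g k.castSucc) (b k.rev) (g k.succ) (d k.rev)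
    else 0

/-- The top boundary spin in the column labeled `j`: the multiplicity of the color `γ_k` is the
number of `i` with `μ_i = j` and `c_i = γ_k`. -/
def topSpin (μ : Fin r → ℤ) (c : Fin r → Fin r) (j : ℤ) : Fin r → ℕ :=
  fun k => (Finset.univ.filter fun i : Fin r => μ i = j ∧ c i = k).card

/-- States of the system with weight `μ`, flags `c, d` and `n` columns labeled `M + n - 1, …, M`
from left to right, so that the column in position `p = 0, …, n - 1` has label `M + (n - 1 - p)`.
There are `r` rows, numbered from top to bottom. `hor i p` is the spin of the horizontal edge of
row `i` to the left of the column in position `p` (to the right of the last column if `p = n`);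
`ver i p` is the spin of the vertical edge in position `p` above row `i` (below the last row if
`i = r`). -/
@[ext]
structure State (μ : Fin r → ℤ) (c d : Fin r → Fin r) (M : ℤ) (n : ℕ) where
  hor : Fin r → Fin (n + 1) → Option (Fin r)
  ver : Fin (r + 1) → Fin n → Fin r → ℕ
  hor_left : ∀ i, hor i 0 = none
  hor_right : ∀ i, hor i (Fin.last n) = some (d i)
  ver_top : ∀ p, ver 0 p = topSpin μ c (M + (p.rev : ℤ))
  ver_bottom : ∀ p, ver (Fin.last r) p = 0

/-- The Boltzmann weight of a state: the product of the weights of all vertices, where the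
vertices in row `i` have spectral parameter `z i`. -/
def State.weight {μ : Fin r → ℤ} {c d : Fin r → Fin r} {M : ℤ} {n : ℕ} (κ : WeightKind) (t : A)
    (z : Fin r → A) (s : State μ c d M n) : A :=
  ∏ i : Fin r, ∏ p : Fin n,
    fusedWeight κ t (z i) (s.hor i p.castSucc) (s.ver i.castSucc p) (s.hor i p.succ)
      (s.ver i.succ p)

/-- The flag `w 𝐜₀`, whose `i`-th color is `γ_{w⁻¹(i)}`; here `𝐜₀ = (γ_1, …, γ_r)`. -/
def flag (w : Equiv.Perm (Fin r)) : Fin r → Fin r := fun i => w⁻¹ i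

end Model

/-- The partition function `Z` of the system: the sum of the Boltzmann weights of its states,
multiplied by `(z_1 ⋯ z_r)^M` for the smallest column label `M` (a factor `1` if the columns are
labeled from `0`, as for partitions). -/
noncomputable def partitionFunction {R : Type*} [CommRing R] [IsDomain R] {r : ℕ}
    (κ : WeightKind) (t : Rˣ) (μ : Fin r → ℤ) (c d : Fin r → Fin r) (M : ℤ) (n : ℕ) :
    RatField R r :=
  (∏ i : Fin r, zvar R i) ^ M *
    ∑ᶠ s : State μ c d M n, s.weight κ (param r t) (zvar R)

end ColoredBoson

/-! Fix the top flag and let the right flag vary. Two facts give the theorem.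

Exchange. If the right spins of rows `i`, `i + 1` have increasing indices, and `Z'` is the partition
function with these spins swapped, then `(z_i - z_{i+1}) Z' = (1 - t) z_{i+1} Z + (t z_i - z_{i+1})
s_i Z`, which is `Z' = 𝓛_{i,t} Z` with the denominators cleared. No R-matrix enters. For two
adjacent rows, let `Φ` and `Ψ` be the vectors of partial partition functions, indexed by the pair of
horizontal spins at the current place, for the two orders of the spectral parameters. Linear
relations between `Φ` and `Ψ` hold at the left boundary and survive every monochrome vertex
(`HalfExchange.step`), so they hold at the right boundary (`rowWeight_exchange`). Inside a fused
vertex one coefficient depends on which colors have been passed; it returns to its initial value at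
the end of the vertex, so the relations propagate along the row. Summing over the remaining rows
gives `rowsSum_exchange`.

Frozen state. If the top and right flags agree, each row must carry its leftmost particle to the
right end, so a single system of vertical spins contributes, and its weight is `t ^ len y` times the
required monomial (`rowsSum_frozen`).

Left multiplication by simple reflections then determines all values: a step up in length applies
`𝓛_{i,t}`, a step down its inverse. This yields the formula for reduced words as well as existence
and uniqueness of the family `τ`. Multiplicities grow by at most one per row, so all sums over
vertical spins are finite. -/

open scoped BigOperators

namespace ColoredBoson

/-! ### Path sums as a transfer-matrix formalism -/

section PathSum

variable {K : Type*} [CommRing K] {S : Type*} [Fintype S] [DecidableEq S]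

/-- The sum over all paths of length `N` from `a` to `b` of the product of the step weights. -/
def pathSum {N : ℕ} (f : Fin N → S → S → K) (a b : S) : K :=
  ∑ g : Fin (N + 1) → S,
    if g 0 = a ∧ g (Fin.last N) = b then ∏ k : Fin N, f k (g k.castSucc) (g k.succ) else 0

theorem pathSum_zero (f : Fin 0 → S → S → K) (a b : S) :
    pathSum f a b = if a = b then 1 else 0 := by
  unfold pathSum
  rw [← (Equiv.funUnique (Fin 1) S).symm.sum_comp]
  by_cases h : a = b
  · subst h
    simp
  · have : ∀ x : S, ¬ (x = a ∧ x = b) := fun x hx => h (hx.1.symm.trans hx.2)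
    simp [h, this]

theorem pathSum_succ {N : ℕ} (f : Fin (N + 1) → S → S → K) (a b : S) :
    pathSum f a b =
      ∑ x, pathSum (fun k : Fin N => f k.castSucc) a x * f (Fin.last N) x b := by
  unfold pathSum
  rw [← (Fin.snocEquiv (fun _ : Fin (N + 2) => S)).sum_comp, Fintype.sum_prod_type]
  simp only [Finset.sum_mul]
  rw [Finset.sum_comm, Finset.sum_comm (s := (Finset.univ : Finset S))]
  refine Finset.sum_congr rfl fun g _ => ?_
  have h0 : ∀ y : S, (Fin.snoc g y : Fin (N + 2) → S) 0 = g 0 := fun y => by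
    rw [← Fin.castSucc_zero, Fin.snoc_castSucc (α := fun _ => S)]
  have hk : ∀ (y : S) (k : Fin N),
      (Fin.snoc g y : Fin (N + 2) → S) k.castSucc.succ = g k.succ := fun y k => by
    rw [Fin.succ_castSucc, Fin.snoc_castSucc (α := fun _ => S)]
  have hs : ∀ (y : S) (k : Fin (N + 1)),
      (Fin.snoc g y : Fin (N + 2) → S) k.castSucc = g k := fun y k => by
    rw [Fin.snoc_castSucc (α := fun _ => S)]
  have hl : ∀ (y : S), (Fin.snoc g y : Fin (N + 2) → S) (Fin.last (N + 1)) = y := fun y => by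
    rw [Fin.snoc_last (α := fun _ => S)]
  simp only [Fin.snocEquiv_apply, Fin.prod_univ_castSucc, h0, hk, hs, hl, Fin.succ_last]
  by_cases h : g 0 = a <;> simp [h]

/-- An invariant of two vectors that is preserved by each step is preserved by the path sums. -/
theorem pathSum_induction₂ {N : ℕ} (f f' : Fin N → S → S → K) (P : ℕ → (S → K) → (S → K) → Prop)
    (ψ ψ' : S → K) (h0 : P 0 ψ ψ')
    (hs : ∀ (k : Fin N) (φ φ' : S → K), P k φ φ' →
      P (k + 1) (fun x => ∑ y, φ y * f k y x) (fun x => ∑ y, φ' y * f' k y x)) :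
    P N (fun x => ∑ y, ψ y * pathSum f y x) (fun x => ∑ y, ψ' y * pathSum f' y x) := by
  induction N with
  | zero => simpa [pathSum_zero] using h0
  | succ N ih =>
    have := hs (Fin.last N) _ _ (ih (fun k => f k.castSucc) (fun k => f' k.castSucc)
      (fun k φ φ' h => hs k.castSucc φ φ' h))
    simp only [Fin.val_last] at this
    convert this using 2 with x x
    · simp only [pathSum_succ, Finset.mul_sum, Finset.sum_mul, mul_assoc]
      rw [Finset.sum_comm]
    · simp only [pathSum_succ, Finset.mul_sum, Finset.sum_mul, mul_assoc]
      rw [Finset.sum_comm]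

/-- An invariant of a vector that is preserved by each step holds for the path sums. -/
theorem pathSum_induction {N : ℕ} (f : Fin N → S → S → K) (P : ℕ → (S → K) → Prop) (a : S)
    (h0 : P 0 (fun x => if x = a then 1 else 0))
    (hs : ∀ (k : Fin N) (φ : S → K), P k φ → P (k + 1) (fun x => ∑ y, φ y * f k y x)) :
    P N (pathSum f a) := by
  have := pathSum_induction₂ f f (fun n φ _ => P n φ) _ (fun _ => 0) h0
    (fun k φ _ h => hs k φ h)
  simpa using this

/-- Two path sums coupled only through an independent choice of `v` at each step form one path sum
on pairs, by distributivity. It is used for two rows sharing their middle vertical spins, both color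
by color and column by column. -/
theorem sum_pathSum_mul_pathSum {N : ℕ} {V : Type*} [DecidableEq V] (D : Finset V)
    (f f' : Fin N → V → S → S → K) (a a' b b' : S) :
    ∑ v ∈ Fintype.piFinset (fun _ : Fin N => D),
        pathSum (fun k => f k (v k)) a b * pathSum (fun k => f' k (v k)) a' b' =
      pathSum (fun k (x y : S × S) => ∑ v ∈ D, f k v x.1 y.1 * f' k v x.2 y.2)
        (a, a') (b, b') := by
  unfold pathSum
  simp only [Finset.sum_mul_sum]
  rw [← (Equiv.arrowProdEquivProdArrow (Fin (N + 1)) (fun _ => S) (fun _ => S)).symm.sum_comp,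
    Fintype.sum_prod_type, Finset.sum_comm]
  refine Finset.sum_congr rfl fun g _ => ?_
  rw [Finset.sum_comm]
  refine Finset.sum_congr rfl fun g' _ => ?_
  simp only [Equiv.arrowProdEquivProdArrow, Equiv.coe_fn_symm_mk, Prod.mk.injEq,
    Finset.prod_univ_sum]
  by_cases h : g 0 = a ∧ g (Fin.last N) = b <;> by_cases h' : g' 0 = a' ∧ g' (Fin.last N) = b'
  · simp [h, h', Finset.prod_mul_distrib]
  · have hn : ¬ ((g 0 = a ∧ g' 0 = a') ∧ g (Fin.last N) = b ∧ g' (Fin.last N) = b') := by tauto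
    simp only [if_neg h', if_neg hn, mul_zero, Finset.sum_const_zero]
  all_goals
    have hn : ¬ ((g 0 = a ∧ g' 0 = a') ∧ g (Fin.last N) = b ∧ g' (Fin.last N) = b') := by tauto
    simp only [if_neg h, if_neg hn, zero_mul, Finset.sum_const_zero]

end PathSum

/-! ### Monochrome vertices acting on vectors of horizontal spins -/

section Mono

variable {K : Type*} [CommRing K] {r : ℕ}

/-- The factor of the weight of a vertex that emits a particle downwards, without `z`. -/
def emit (κ : WeightKind) (t : K) (n : ℕ) : K :=
  match κ with
  | .P => 1 - t ^ (n + 1)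
  | .R => 1 - t

/-- The weight of a vertex that absorbs a particle from above. -/
def absorb (κ : WeightKind) (t : K) (n : ℕ) : K :=
  match κ with
  | .P => 1
  | .R => ∑ k ∈ Finset.range (n + 1), t ^ k

/-- The `P`- and `R`-weights differ only in how this product is split into two factors, so one
computation serves both. -/
theorem emit_mul_absorb (κ : WeightKind) (t : K) (n : ℕ) :
    emit κ t n * absorb κ t n = 1 - t ^ (n + 1) := by
  cases κ
  · simp [emit, absorb]
  · simp only [emit, absorb]
    exact mul_neg_geom_sum t (n + 1)

theorem absorb_zero (κ : WeightKind) (t : K) : absorb κ t 0 = 1 := by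
  cases κ <;> simp [absorb]

/-- The weight with which the color `d` passes the monochrome vertex of another color `c`. -/
def pass (t : K) (c d : Fin r) (n : ℕ) : K := if d < c then 1 else t ^ n

variable (κ : WeightKind) (t z : K) (c : Fin r) (n m : ℕ)

theorem sum_mul_monoWeight_none (ψ : Option (Fin r) → K) :
    ∑ x, ψ x * monoWeight κ t z c x n none m =
      (if m = n then ψ none else 0) + if m = n + 1 then z * emit κ t n * ψ (some c) else 0 := by
  rw [Fintype.sum_option]
  congr 1
  · simp [monoWeight]
  · rw [Finset.sum_eq_single c]
    · cases κ <;> simp [monoWeight, emit, mul_comm]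
    · intro b _ hb
      simp [monoWeight, hb]
    · simp

theorem sum_mul_monoWeight_self (ψ : Option (Fin r) → K) :
    ∑ x, ψ x * monoWeight κ t z c x n (some c) m =
      (if n = m + 1 then absorb κ t m * ψ none else 0) +
        if m = n then z * ψ (some c) else 0 := by
  rw [Fintype.sum_option]
  congr 1
  · cases κ <;> simp [monoWeight, absorb, mul_comm]
  · rw [Finset.sum_eq_single c]
    · simp [monoWeight, mul_comm]
    · intro b _ hb
      simp [monoWeight, hb]
    · simp

theorem sum_mul_monoWeight_of_ne (ψ : Option (Fin r) → K) {d : Fin r} (hd : d ≠ c) :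
    ∑ x, ψ x * monoWeight κ t z c x n (some d) m =
      if m = n then pass t c d n * ψ (some d) else 0 := by
  rw [Fintype.sum_option, Finset.sum_eq_single d]
  · simp only [monoWeight, hd, hd.symm, pass]
    simp [mul_comm]
  · intro b _ hb
    simp [monoWeight, hb]
  · simp

end Mono

/-! ### Two stacked monochrome vertices -/

section Exchange

variable {K : Type*} [Field K] {r : ℕ}

/-- The exchange relations between the vectors `Φ` and `Ψ` of two-row partition functions, for the
order `z₁, z₂` and the order `z₂, z₁` of the spectral parameters, after the monochrome vertices of
the colors `k ≥ p` in a column. -/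
structure HalfExchange (t z₁ z₂ : K) (p : ℕ) (Φ Ψ : Option (Fin r) × Option (Fin r) → K) :
    Prop where
  diag : ∀ a, Φ (a, a) = Ψ (a, a)
  vac : ∀ e, (z₁ - z₂) * Φ (none, some e) =
    (1 - t) * z₁ * Φ (some e, none) + (t * z₁ - z₂) * Ψ (some e, none)
  col : ∀ a b, a < b → (z₁ - z₂) * Φ (some b, some a) =
    (1 - t) * (if a.1 < p ∧ p ≤ b.1 then z₁ else z₂) * Φ (some a, some b) +
      (t * z₁ - z₂) * Ψ (some a, some b)

/-- The exchange relations together with the same relations for `z₁` and `z₂` interchanged. -/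
def Exchange (t z₁ z₂ : K) (p : ℕ) (Φ Ψ : Option (Fin r) × Option (Fin r) → K) : Prop :=
  HalfExchange t z₁ z₂ p Φ Ψ ∧ HalfExchange t z₂ z₁ p Ψ Φ

/-- The weight of two monochrome vertices on top of each other. -/
def monoPair (κ : WeightKind) (t z₁ z₂ : K) (D : Finset ℕ) (c : Fin r) (n m : ℕ)
    (x y : Option (Fin r) × Option (Fin r)) : K :=
  ∑ v ∈ D, monoWeight κ t z₁ c x.1 n y.1 v * monoWeight κ t z₂ c x.2 v y.2 m

theorem sum_mul_monoPair (κ : WeightKind) (t z₁ z₂ : K) (D : Finset ℕ) (c : Fin r) (n m : ℕ)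
    (Φ : Option (Fin r) × Option (Fin r) → K) (a b : Option (Fin r)) :
    ∑ x, Φ x * monoPair κ t z₁ z₂ D c n m x (a, b) =
      ∑ v ∈ D, ∑ y, (∑ x, Φ (x, y) * monoWeight κ t z₁ c x n a v) *
        monoWeight κ t z₂ c y v b m := by
  simp only [monoPair, Finset.mul_sum, Finset.sum_mul, Fintype.sum_prod_type]
  rw [Finset.sum_comm' (t' := Finset.univ) (s' := fun _ => Finset.univ) (by simp)]
  rw [Finset.sum_comm' (s := D) (t' := Finset.univ) (s' := fun _ => D) (by simp)]
  refine Finset.sum_congr rfl fun y _ => ?_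
  rw [Finset.sum_comm]
  refine Finset.sum_congr rfl fun v _ => Finset.sum_congr rfl fun x _ => by ring

variable (κ : WeightKind) (t z₁ z₂ : K) (D : Finset ℕ) (c : Fin r) (n m : ℕ)
    (Φ : Option (Fin r) × Option (Fin r) → K)

/-- In this and the following formulas, conservation of particles leaves at most two values for the
middle multiplicity. The hypotheses on `D` ensure that truncating the sum to `D` loses none of them.
-/
theorem sum_mul_monoPair_generic {d e : Fin r} (hd : d ≠ c) (he : e ≠ c) (hn : n ∈ D) :
    ∑ x, Φ x * monoPair κ t z₁ z₂ D c n m x (some d, some e) =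
      if m = n then pass t c d n * pass t c e n * Φ (some d, some e) else 0 := by
  rw [sum_mul_monoPair]
  simp only [sum_mul_monoWeight_of_ne κ t _ c _ _ _ hd, sum_mul_monoWeight_of_ne κ t _ c _ _ _ he]
  rw [Finset.sum_eq_single n]
  · simp only [if_true]
    split_ifs <;> ring
  · intro v _ hv
    simp [hv]
  · exact fun h => absurd hn h

theorem sum_mul_monoPair_ne_none {d : Fin r} (hd : d ≠ c) (hn : n ∈ D) :
    ∑ x, Φ x * monoPair κ t z₁ z₂ D c n m x (some d, none) =
      pass t c d n * ((if m = n then Φ (some d, none) else 0) +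
        if m = n + 1 then z₂ * emit κ t n * Φ (some d, some c) else 0) := by
  rw [sum_mul_monoPair]
  simp only [sum_mul_monoWeight_of_ne κ t _ c _ _ _ hd, sum_mul_monoWeight_none]
  rw [Finset.sum_eq_single n]
  · simp only [if_true]
    split_ifs <;> ring
  · intro v _ hv
    simp [hv]
  · exact fun h => absurd hn h

theorem sum_mul_monoPair_none_ne {d : Fin r} (hd : d ≠ c) (hn : n ∈ D) (hn' : n + 1 ∈ D) :
    ∑ x, Φ x * monoPair κ t z₁ z₂ D c n m x (none, some d) =
      pass t c d m * ((if m = n then Φ (none, some d) else 0) +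
        if m = n + 1 then z₁ * emit κ t n * Φ (some c, some d) else 0) := by
  rw [sum_mul_monoPair]
  simp only [sum_mul_monoWeight_of_ne κ t _ c _ _ _ hd, sum_mul_monoWeight_none]
  by_cases hm : m ∈ D
  · rw [Finset.sum_eq_single m]
    · simp only [if_true]
    · intro v _ hv
      simp [hv.symm]
    · exact fun h => absurd hm h
  · rw [Finset.sum_eq_zero, if_neg, if_neg]
    · simp
    · rintro rfl; exact hm hn'
    · rintro rfl; exact hm hn
    · intro v hv
      rw [if_neg]
      rintro rfl; exact hm hv

theorem sum_mul_monoPair_ne_self {d : Fin r} (hd : d ≠ c) (hn : n ∈ D) :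
    ∑ x, Φ x * monoPair κ t z₁ z₂ D c n m x (some d, some c) =
      pass t c d n * ((if n = m + 1 then absorb κ t m * Φ (some d, none) else 0) +
        if m = n then z₂ * Φ (some d, some c) else 0) := by
  rw [sum_mul_monoPair]
  simp only [sum_mul_monoWeight_of_ne κ t _ c _ _ _ hd, sum_mul_monoWeight_self]
  rw [Finset.sum_eq_single n]
  · simp only [if_true]
    split_ifs <;> ring
  · intro v _ hv
    simp [hv]
  · exact fun h => absurd hn h

theorem sum_mul_monoPair_self_ne {d : Fin r} (hd : d ≠ c) (hm : m ≤ n → m ∈ D) :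
    ∑ x, Φ x * monoPair κ t z₁ z₂ D c n m x (some c, some d) =
      pass t c d m * ((if n = m + 1 then absorb κ t m * Φ (none, some d) else 0) +
        if m = n then z₁ * Φ (some c, some d) else 0) := by
  rw [sum_mul_monoPair]
  simp only [sum_mul_monoWeight_of_ne κ t _ c _ _ _ hd, sum_mul_monoWeight_self]
  by_cases hm' : m ∈ D
  · rw [Finset.sum_eq_single m]
    · simp only [if_true]
    · intro v _ hv
      simp [hv.symm]
    · exact fun h => absurd hm' h
  · rw [Finset.sum_eq_zero, if_neg, if_neg]
    · simp
    · rintro rfl; exact hm' (hm le_rfl)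
    · rintro rfl; exact hm' (hm (by omega))
    · intro v hv
      rw [if_neg]
      rintro rfl; exact hm' hv

theorem sum_mul_monoPair_none_none (hn : n ∈ D) (hn' : n + 1 ∈ D) :
    ∑ x, Φ x * monoPair κ t z₁ z₂ D c n m x (none, none) =
      (if m = n then Φ (none, none) else 0) +
      (if m = n + 1 then emit κ t n * (z₁ * Φ (some c, none) + z₂ * Φ (none, some c)) else 0) +
      if m = n + 2 then z₁ * z₂ * emit κ t n * emit κ t (n + 1) * Φ (some c, some c) else 0 := by
  rw [sum_mul_monoPair]
  simp only [sum_mul_monoWeight_none]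
  rw [Finset.sum_eq_add n (n + 1) (by omega)]
  · simp only [Nat.left_eq_add, Nat.add_eq_left, one_ne_zero, if_true, if_false, add_zero, zero_add,
      add_assoc, Nat.reduceAdd]
    split_ifs <;> first | omega | ring
  · rintro v _ ⟨h, h'⟩
    simp [h, h']
  · exact fun h => absurd hn h
  · exact fun h => absurd hn' h

theorem sum_mul_monoPair_none_self (hn : n ∈ D) (hn' : n + 1 ∈ D) :
    ∑ x, Φ x * monoPair κ t z₁ z₂ D c n m x (none, some c) =
      (if n = m + 1 then absorb κ t m * Φ (none, none) else 0) +
      (if m = n then z₂ * Φ (none, some c) + z₁ * (1 - t ^ (n + 1)) * Φ (some c, none) else 0) +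
      if m = n + 1 then z₁ * z₂ * emit κ t n * Φ (some c, some c) else 0 := by
  rw [sum_mul_monoPair]
  simp only [sum_mul_monoWeight_none, sum_mul_monoWeight_self]
  rw [Finset.sum_eq_add n (n + 1) (by omega), ← emit_mul_absorb κ]
  · simp only [Nat.left_eq_add, Nat.add_eq_left, one_ne_zero, if_true, if_false, add_zero, zero_add,
      add_assoc, add_left_inj]
    split_ifs <;> first | omega | (subst_vars; ring)
  · rintro v _ ⟨h, h'⟩
    simp [h, h']
  · exact fun h => absurd hn h
  · exact fun h => absurd hn' h

theorem sum_mul_monoPair_self_none (hD : ∀ v ≤ n, v ∈ D) :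
    ∑ x, Φ x * monoPair κ t z₁ z₂ D c n m x (some c, none) =
      (if n = m + 1 then absorb κ t m * Φ (none, none) else 0) +
      (if m = n then z₁ * Φ (some c, none) + z₂ * (1 - t ^ n) * Φ (none, some c) else 0) +
      if m = n + 1 then z₁ * z₂ * emit κ t n * Φ (some c, some c) else 0 := by
  rw [sum_mul_monoPair]
  simp only [sum_mul_monoWeight_none, sum_mul_monoWeight_self]
  -- If the upper vertex absorbs, the middle multiplicity is `n - 1`. For `n = 0` this value does
  -- not exist, in agreement with the factor `1 - t ^ 0 = 0`.
  cases n with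
  | zero =>
    rw [Finset.sum_eq_single 0]
    · simp
      split_ifs <;> first | omega | (subst_vars; ring)
    · intro v _ h
      simp [h]
    · exact fun h => absurd (hD 0 le_rfl) h
  | succ n =>
    rw [Finset.sum_eq_add n (n + 1) (by omega), ← emit_mul_absorb κ]
    · simp only [Nat.left_eq_add, one_ne_zero, if_true, if_false, add_zero,
        zero_add, add_assoc, Nat.reduceAdd, add_left_inj]
      split_ifs <;> first | omega | (subst_vars; ring)
    · rintro v _ ⟨h, h'⟩
      simp [h', Ne.symm h]
    · exact fun h => absurd (hD _ (by omega)) h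
    · exact fun h => absurd (hD _ (by omega)) h

theorem sum_mul_monoPair_self_self (hD : ∀ v ≤ n, v ∈ D) :
    ∑ x, Φ x * monoPair κ t z₁ z₂ D c n m x (some c, some c) =
      (if n = m + 2 then absorb κ t m * absorb κ t (m + 1) * Φ (none, none) else 0) +
      (if n = m + 1 then absorb κ t m * (z₁ * Φ (some c, none) + z₂ * Φ (none, some c)) else 0) +
      if m = n then z₁ * z₂ * Φ (some c, some c) else 0 := by
  rw [sum_mul_monoPair]
  simp only [sum_mul_monoWeight_self]
  cases n with
  | zero =>
    rw [Finset.sum_eq_single 0]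
    · simp
      split_ifs <;> first | omega | (subst_vars; ring)
    · intro v _ h
      simp [h]
    · exact fun h => absurd (hD 0 le_rfl) h
  | succ n =>
    rw [Finset.sum_eq_add n (n + 1) (by omega)]
    · simp only [Nat.left_eq_add, one_ne_zero, if_true, if_false, add_zero,
        zero_add, add_assoc, Nat.reduceAdd, add_left_inj]
      split_ifs <;> first | omega | (subst_vars; ring)
    · rintro v _ ⟨h, h'⟩
      simp [h', Ne.symm h]
    · exact fun h => absurd (hD _ (by omega)) h
    · exact fun h => absurd (hD _ (by omega)) h

end Exchange

/-! ### The exchange relations survive a monochrome vertex -/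

section ExchangeStep

variable {K : Type*} [Field K] {r : ℕ}

/-- Elimination of `A'` from the two relations, where the coefficient of `A` simplifies by `(t z₁ -
z₂)(t z₂ - z₁) - (1 - t)² z₁ z₂ = -t (z₁ - z₂)²`. -/
theorem exchange_inverse {t z₁ z₂ A A' B B' : K} (hz : z₁ ≠ z₂)
    (h : (z₁ - z₂) * B = (1 - t) * z₁ * A + (t * z₁ - z₂) * A')
    (h' : (z₂ - z₁) * B' = (1 - t) * z₂ * A' + (t * z₂ - z₁) * A) :
    t * (z₁ - z₂) * A = (1 - t) * z₂ * B + (t * z₁ - z₂) * B' := by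
  refine mul_left_cancel₀ (sub_ne_zero.2 hz) ?_
  linear_combination -(1 - t) * z₂ * h + (t * z₁ - z₂) * h'

/-- Each new component combines few old ones, so every relation after the vertex is a combination of
relations before it. Both halves of the exchange are needed as input, since some cases use the
inverted relations. -/
theorem HalfExchange.step {t z₁ z₂ : K} (hz : z₁ ≠ z₂) (κ : WeightKind) {D : Finset ℕ}
    (c : Fin r) (n m : ℕ) (hD : ∀ v ≤ n + 1, v ∈ D)
    {Φ Ψ : Option (Fin r) × Option (Fin r) → K} (h : Exchange t z₁ z₂ (c + 1) Φ Ψ) :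
    HalfExchange t z₁ z₂ c (fun y => ∑ x, Φ x * monoPair κ t z₁ z₂ D c n m x y)
      (fun y => ∑ x, Ψ x * monoPair κ t z₂ z₁ D c n m x y) := by
  obtain ⟨h₁, h₂⟩ := h
  have hn : n ∈ D := hD n (by omega)
  have hn' : n + 1 ∈ D := hD _ le_rfl
  have hDn : ∀ v ≤ n, v ∈ D := fun v hv => hD v (by omega)
  have hz' := sub_ne_zero.2 hz
  -- This combination, which enters the diagonal components, is unchanged when the two parameters
  -- are interchanged.
  have key : z₁ * Φ (some c, none) + z₂ * Φ (none, some c) =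
      z₂ * Ψ (some c, none) + z₁ * Ψ (none, some c) := by
    refine mul_left_cancel₀ hz' ?_
    linear_combination z₂ * h₁.vac c + z₁ * h₂.vac c
  have hd0 := h₁.diag none
  have hdc := h₁.diag (some c)
  -- A color passing in the upper or the lower row may see multiplicities that differ by one. The
  -- resulting extra factor `t` is supplied by the inverted relations.
  have hinv : ∀ e, t * (z₁ - z₂) * Φ (some e, none) =
      (1 - t) * z₂ * Φ (none, some e) + (t * z₁ - z₂) * Ψ (none, some e) :=
    fun e => exchange_inverse hz (h₁.vac e) (h₂.vac e)
  have hcol : ∀ e, c < e → t * (z₁ - z₂) * Φ (some c, some e) =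
      (1 - t) * z₂ * Φ (some e, some c) + (t * z₁ - z₂) * Ψ (some e, some c) := fun e he => by
    have e₁ := h₁.col c e he
    have e₂ := h₂.col c e he
    -- The threshold `c + 1` separates `c` from `e`, so the coefficient is `z₁`, as in the vacuum
    -- relation, and the same inversion applies.
    have hc : c.1 < c.1 + 1 ∧ c.1 + 1 ≤ e.1 := ⟨by omega, he⟩
    rw [if_pos hc] at e₁ e₂
    exact exchange_inverse hz e₁ e₂
  refine ⟨?_, ?_, ?_⟩
  · rintro (_ | d)
    · rw [sum_mul_monoPair_none_none _ _ _ _ _ _ _ _ _ hn hn',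
        sum_mul_monoPair_none_none _ _ _ _ _ _ _ _ _ hn hn', key, hd0, hdc, mul_comm z₁ z₂]
    · by_cases hd : d = c
      · subst hd
        rw [sum_mul_monoPair_self_self _ _ _ _ _ _ _ _ _ hDn,
          sum_mul_monoPair_self_self _ _ _ _ _ _ _ _ _ hDn, key, hd0, hdc, mul_comm z₁ z₂]
      · rw [sum_mul_monoPair_generic _ _ _ _ _ _ _ _ _ hd hd hn,
          sum_mul_monoPair_generic _ _ _ _ _ _ _ _ _ hd hd hn, h₁.diag]
  · intro e
    by_cases he : e = c
    · subst he
      rw [sum_mul_monoPair_none_self _ _ _ _ _ _ _ _ _ hn hn',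
        sum_mul_monoPair_self_none _ _ _ _ _ _ _ _ _ hDn,
        sum_mul_monoPair_self_none _ _ _ _ _ _ _ _ _ hDn]
      split_ifs with i₁ i₂ i₃ i₂ i₃ i₃ <;> try omega
      · linear_combination (t * z₁ - z₂) * absorb κ t m * hd0
      · linear_combination z₂ * h₁.vac e + z₁ * (1 - t ^ n) * hinv e
      · linear_combination (t * z₁ - z₂) * z₁ * z₂ * emit κ t n * hdc
      · ring
    · rw [sum_mul_monoPair_none_ne _ _ _ _ _ _ _ _ _ he hn hn',
        sum_mul_monoPair_ne_none _ _ _ _ _ _ _ _ _ he hn,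
        sum_mul_monoPair_ne_none _ _ _ _ _ _ _ _ _ he hn]
      rcases lt_or_gt_of_ne he with hlt | hgt
      · have hcol' := h₁.col e c hlt
        rw [if_neg (by omega)] at hcol'
        simp only [pass, if_pos hlt]
        split_ifs <;> try omega
        · linear_combination h₁.vac e
        · linear_combination z₁ * emit κ t n * hcol'
        · ring
      · simp only [pass, if_neg hgt.not_gt]
        split_ifs with i₁ i₂ i₂ <;> try omega
        · subst i₁
          linear_combination t ^ m * h₁.vac e
        · subst i₂
          linear_combination t ^ n * z₁ * emit κ t n * hcol e hgt
        · ring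
  · intro a b hab
    by_cases ha : a = c
    · subst ha
      -- After the vertex of its own color, `a` lies on the same side of the threshold as `b`: the
      -- factors `z` of that vertex turn the coefficient `z₁` into `z₂`.
      rw [if_neg (by omega), sum_mul_monoPair_ne_self _ _ _ _ _ _ _ _ _ hab.ne' hn,
        sum_mul_monoPair_self_ne _ _ _ _ _ _ _ _ _ hab.ne' (hDn m),
        sum_mul_monoPair_self_ne _ _ _ _ _ _ _ _ _ hab.ne' (hDn m)]
      simp only [pass, if_neg hab.not_gt]
      have e₁ := h₁.col a b hab
      rw [if_pos ⟨by omega, hab⟩] at e₁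
      split_ifs with i₁ i₂ i₂ <;> try omega
      · subst i₁
        linear_combination t ^ m * absorb κ t m * hinv b
      · subst i₂
        linear_combination t ^ m * z₂ * e₁
      · ring
    · by_cases hb : b = c
      · subst hb
        -- Here the threshold starts to separate `a` from `b`, and the coefficient changes from `z₂`
        -- to `z₁`.
        rw [if_pos ⟨hab, le_rfl⟩, sum_mul_monoPair_self_ne _ _ _ _ _ _ _ _ _ ha (hDn m),
          sum_mul_monoPair_ne_self _ _ _ _ _ _ _ _ _ ha hn,
          sum_mul_monoPair_ne_self _ _ _ _ _ _ _ _ _ ha hn]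
        simp only [pass, if_pos hab]
        have e₁ := h₁.col a b hab
        rw [if_neg (by omega)] at e₁
        split_ifs with i₁ i₂ i₂ <;> try omega
        · linear_combination absorb κ t m * h₁.vac a
        · linear_combination z₁ * e₁
        · ring
      · rw [sum_mul_monoPair_generic _ _ _ _ _ _ _ _ _ ha hb hn,
          sum_mul_monoPair_generic _ _ _ _ _ _ _ _ _ hb ha hn,
          sum_mul_monoPair_generic _ _ _ _ _ _ _ _ _ ha hb hn]
        have e₁ := h₁.col a b hab
        have hiff : (a.1 < c.1 + 1 ∧ c.1 + 1 ≤ b.1) ↔ (a.1 < c.1 ∧ c.1 ≤ b.1) := by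
          have := Fin.val_ne_of_ne ha
          have := Fin.val_ne_of_ne hb
          omega
        simp only [hiff] at e₁
        by_cases hm : m = n
        · simp only [if_pos hm]
          linear_combination pass t c a n * pass t c b n * e₁
        · simp only [if_neg hm]
          ring

end ExchangeStep

/-! ### Exchange for fused vertices and for two full rows -/

section RowExchange

variable {K : Type*} [Field K] {r : ℕ}

theorem Exchange.step {t z₁ z₂ : K} (hz : z₁ ≠ z₂) (κ : WeightKind) {D : Finset ℕ}
    (c : Fin r) (n m : ℕ) (hD : ∀ v ≤ n + 1, v ∈ D)
    {Φ Ψ : Option (Fin r) × Option (Fin r) → K} (h : Exchange t z₁ z₂ (c + 1) Φ Ψ) :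
    Exchange t z₁ z₂ c (fun y => ∑ x, Φ x * monoPair κ t z₁ z₂ D c n m x y)
      (fun y => ∑ x, Ψ x * monoPair κ t z₂ z₁ D c n m x y) :=
  ⟨HalfExchange.step hz κ c n m hD h, HalfExchange.step hz.symm κ c n m hD ⟨h.2, h.1⟩⟩

/-- Neither threshold separates two colors. Thus the relations at the end of one fused vertex are
those needed at the start of the next. -/
theorem HalfExchange.zero_iff {t z₁ z₂ : K} {Φ Ψ : Option (Fin r) × Option (Fin r) → K} :
    HalfExchange t z₁ z₂ 0 Φ Ψ ↔ HalfExchange t z₁ z₂ r Φ Ψ := by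
  have e : ∀ a b : Fin r, (if a.1 < 0 ∧ 0 ≤ b.1 then z₁ else z₂) =
      if a.1 < r ∧ r ≤ b.1 then z₁ else z₂ := fun a b => by
    rw [if_neg (by omega), if_neg (by omega)]
  exact ⟨fun h => ⟨h.diag, h.vac, fun a b hab => by rw [← e]; exact h.col a b hab⟩,
    fun h => ⟨h.diag, h.vac, fun a b hab => by rw [e]; exact h.col a b hab⟩⟩

/-- The weight of two fused vertices on top of each other. -/
def fusedPair (κ : WeightKind) (t z₁ z₂ : K) (D : Finset ℕ) (T B : Fin r → ℕ)
    (x y : Option (Fin r) × Option (Fin r)) : K :=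
  ∑ V ∈ Fintype.piFinset (fun _ : Fin r => D),
    fusedWeight κ t z₁ x.1 T y.1 V * fusedWeight κ t z₂ x.2 V y.2 B

theorem fusedWeight_eq_pathSum (κ : WeightKind) (t z : K) (a : Option (Fin r)) (T : Fin r → ℕ)
    (b : Option (Fin r)) (V : Fin r → ℕ) :
    fusedWeight κ t z a T b V =
      pathSum (fun k x y => monoWeight κ t z k.rev x (T k.rev) y (V k.rev)) a b := rfl

/-- A middle multiset is an independent choice of one multiplicity per color, so the sum over it can
be carried out vertex by vertex. -/
theorem fusedPair_eq_pathSum (κ : WeightKind) (t z₁ z₂ : K) (D : Finset ℕ) (T B : Fin r → ℕ)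
    (x y : Option (Fin r) × Option (Fin r)) :
    fusedPair κ t z₁ z₂ D T B x y =
      pathSum (fun k : Fin r => monoPair κ t z₁ z₂ D k.rev (T k.rev) (B k.rev)) x y := by
  have := sum_pathSum_mul_pathSum D
    (fun (k : Fin r) v a b => monoWeight κ t z₁ k.rev a (T k.rev) b v)
    (fun (k : Fin r) v a b => monoWeight κ t z₂ k.rev a v b (B k.rev)) x.1 x.2 y.1 y.2
  refine Eq.trans ?_ this
  refine Finset.sum_equiv (Equiv.arrowCongr Fin.revPerm (Equiv.refl ℕ)) (fun V => ?_)
    (fun V _ => ?_)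
  · simp only [Fintype.mem_piFinset]
    exact ⟨fun h k => h k.rev, fun h k => by simpa using h k.rev⟩
  · rfl

theorem Exchange.fused_step {t z₁ z₂ : K} (hz : z₁ ≠ z₂) (κ : WeightKind) {D : Finset ℕ}
    (T B : Fin r → ℕ) (hD : ∀ k, ∀ v ≤ T k + 1, v ∈ D)
    {Φ Ψ : Option (Fin r) × Option (Fin r) → K} (h : Exchange t z₁ z₂ 0 Φ Ψ) :
    Exchange t z₁ z₂ 0 (fun y => ∑ x, Φ x * fusedPair κ t z₁ z₂ D T B x y)
      (fun y => ∑ x, Ψ x * fusedPair κ t z₂ z₁ D T B x y) := by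
  simp only [fusedPair_eq_pathSum]
  have := pathSum_induction₂
    (fun k : Fin r => monoPair κ t z₁ z₂ D k.rev (T k.rev) (B k.rev))
    (fun k : Fin r => monoPair κ t z₂ z₁ D k.rev (T k.rev) (B k.rev))
    (fun k => Exchange t z₁ z₂ (r - k)) Φ Ψ
    ⟨HalfExchange.zero_iff.1 h.1, HalfExchange.zero_iff.1 h.2⟩ ?_
  · simpa using this
  · intro k φ φ' hφ
    have hk : r - (k : ℕ) = (k.rev : ℕ) + 1 := by
      rw [Fin.val_rev]
      omega
    have hk' : r - ((k : ℕ) + 1) = (k.rev : ℕ) := by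
      rw [Fin.val_rev]
    rw [hk] at hφ
    rw [hk']
    exact hφ.step hz κ k.rev _ _ (hD k.rev)

/-- The partition function of a row with left spin `a` and right spin `b`. -/
def rowWeight (κ : WeightKind) (t z : K) {n : ℕ} (T V : Fin n → Fin r → ℕ)
    (a b : Option (Fin r)) : K :=
  pathSum (fun p x y => fusedWeight κ t z x (T p) y (V p)) a b

/-- The configurations of a row of vertical edges with all multiplicities in `D`. -/
def configs (r n : ℕ) (D : Finset ℕ) : Finset (Fin n → Fin r → ℕ) :=
  Fintype.piFinset fun _ => Fintype.piFinset fun _ => D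

theorem mem_configs {n : ℕ} {D : Finset ℕ} {V : Fin n → Fin r → ℕ} :
    V ∈ configs r n D ↔ ∀ p k, V p k ∈ D := by
  simp [configs]

/-- The exchange relation for two adjacent rows. -/
theorem rowWeight_exchange {t z₁ z₂ : K} (hz : z₁ ≠ z₂) (κ : WeightKind) {D : Finset ℕ} {n : ℕ}
    (T B : Fin n → Fin r → ℕ) (hD : ∀ p k, ∀ v ≤ T p k + 1, v ∈ D) {a b : Fin r} (hab : a < b) :
    (z₁ - z₂) * ∑ V ∈ configs r n D,
        rowWeight κ t z₁ T V none (some b) * rowWeight κ t z₂ V B none (some a) =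
      (1 - t) * z₂ * ∑ V ∈ configs r n D,
        rowWeight κ t z₁ T V none (some a) * rowWeight κ t z₂ V B none (some b) +
      (t * z₁ - z₂) * ∑ V ∈ configs r n D,
        rowWeight κ t z₂ T V none (some a) * rowWeight κ t z₁ V B none (some b) := by
  have e : ∀ (w₁ w₂ : K) (c d : Option (Fin r)), ∑ V ∈ configs r n D,
      rowWeight κ t w₁ T V none c * rowWeight κ t w₂ V B none d =
      pathSum (fun p => fusedPair κ t w₁ w₂ D (T p) (B p)) (none, none) (c, d) :=
    fun w₁ w₂ c d => sum_pathSum_mul_pathSum (Fintype.piFinset fun _ : Fin r => D)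
      (fun p V x y => fusedWeight κ t w₁ x (T p) y V)
      (fun p V x y => fusedWeight κ t w₂ x V y (B p)) none none c d
  -- At the left boundary both vectors are concentrated at `(none, none)`, so only the diagonal
  -- relation has content.
  have start : HalfExchange t z₁ z₂ 0
      (fun x : Option (Fin r) × Option (Fin r) => if x = (none, none) then 1 else 0)
      (fun x => if x = (none, none) then 1 else 0) :=
    ⟨fun _ => rfl, fun _ => by simp, fun _ _ _ => by simp⟩
  have start' : HalfExchange t z₂ z₁ 0
      (fun x : Option (Fin r) × Option (Fin r) => if x = (none, none) then 1 else 0)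
      (fun x => if x = (none, none) then 1 else 0) :=
    ⟨fun _ => rfl, fun _ => by simp, fun _ _ _ => by simp⟩
  have h := pathSum_induction₂
    (fun p => fusedPair κ t z₁ z₂ D (T p) (B p)) (fun p => fusedPair κ t z₂ z₁ D (T p) (B p))
    (fun _ => Exchange t z₁ z₂ 0) _ _ ⟨start, start'⟩
    (fun p φ φ' hφ => hφ.fused_step hz κ (T p) (B p) (hD p))
  have := h.1.col a b hab
  simpa [e] using this

end RowExchange

/-! ### Rows that transport a single particle -/

section FrozenRow

variable {K : Type*} [Field K] {r : ℕ}

theorem sum_ite_le (c : Fin r) (P : Fin r → Prop) [DecidablePred P] (F : Fin r → ℕ) :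
    (∑ j : Fin r, if c.1 ≤ j.1 ∧ P j then F j else 0) =
      (if P c then F c else 0) + ∑ j : Fin r, if c.1 + 1 ≤ j.1 ∧ P j then F j else 0 := by
  have : (if P c then F c else 0) = ∑ j : Fin r, if j = c then (if P j then F j else 0) else 0 := by
    simp
  rw [this, ← Finset.sum_add_distrib]
  refine Finset.sum_congr rfl fun j _ => ?_
  by_cases hj : j = c
  · subst hj
    simp
  · have : j.1 ≠ c.1 := Fin.val_ne_of_ne hj
    have hiff : c.1 ≤ j.1 ↔ c.1 + 1 ≤ j.1 := by omega
    simp [hj, hiff]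

theorem forall_le_iff (c : Fin r) (P : Fin r → Prop) :
    (∀ j : Fin r, c.1 ≤ j.1 → P j) ↔ P c ∧ ∀ j : Fin r, c.1 + 1 ≤ j.1 → P j := by
  refine ⟨fun h => ⟨h c le_rfl, fun j hj => h j (by omega)⟩, fun h j hj => ?_⟩
  rcases hj.eq_or_lt with e | e
  · rw [← Fin.ext e]
    exact h.1
  · exact h.2 j e

/-- The state of a vector of partition functions with left spin `+` after the monochrome vertices
of the colors `k ≥ q`. -/
structure FromVacuum (κ : WeightKind) (t : K) (T V : Fin r → ℕ) (q : ℕ)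
    (φ : Option (Fin r) → K) : Prop where
  vac : φ none = if ∀ j : Fin r, q ≤ j.1 → V j = T j then 1 else 0
  lt : ∀ d : Fin r, d.1 < q → φ (some d) = 0
  ge : ∀ d : Fin r, q ≤ d.1 → φ (some d) =
    if ∀ j : Fin r, q ≤ j.1 → T j = V j + if j = d then 1 else 0 then
      absorb κ t (V d) * t ^ (∑ j : Fin r, if q ≤ j.1 ∧ j < d then T j else 0) else 0

theorem fusedWeight_fromVacuum (κ : WeightKind) (t z : K) (T V : Fin r → ℕ) :
    FromVacuum κ t T V 0 (fun y => fusedWeight κ t z none T y V) := by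
  have := pathSum_induction
    (fun k x y => monoWeight κ t z k.rev x (T k.rev) y (V k.rev))
    (fun k => FromVacuum κ t T V (r - k)) none ?_ ?_
  · simpa [fusedWeight_eq_pathSum] using this
  · refine ⟨?_, fun d _ => by simp, fun d hd => absurd hd (by simp)⟩
    rw [if_pos rfl, if_pos]
    intro j hj
    exact absurd hj (by simp)
  · intro k φ hφ
    have hk : r - (k : ℕ) = (k.rev : ℕ) + 1 := by
      rw [Fin.val_rev]
      omega
    have hk' : r - ((k : ℕ) + 1) = (k.rev : ℕ) := by
      rw [Fin.val_rev]
    rw [hk] at hφ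
    rw [hk']
    generalize k.rev = c at hφ ⊢
    refine ⟨?_, ?_, ?_⟩
    · rw [sum_mul_monoWeight_none, hφ.lt c (by omega), hφ.vac]
      simp only [forall_le_iff c (fun j => V j = T j), ite_and]
      simp
    · intro d hd
      rw [sum_mul_monoWeight_of_ne _ _ _ _ _ _ _ (Fin.ne_of_val_ne hd.ne), hφ.lt d (by omega)]
      simp
    · intro d hd
      simp only [forall_le_iff c (fun j => T j = V j + if j = d then 1 else 0)]
      rw [sum_ite_le c (fun j => j < d)]
      by_cases hdc : d = c
      · subst hdc
        rw [sum_mul_monoWeight_self, hφ.lt d (by omega), hφ.vac]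
        have e : (∀ j : Fin r, d.1 + 1 ≤ j.1 → T j = V j + if j = d then 1 else 0) ↔
            ∀ j : Fin r, d.1 + 1 ≤ j.1 → V j = T j := by
          refine forall_congr' fun j => forall_congr' fun hj => ?_
          rw [if_neg (by rintro rfl; omega), add_zero, eq_comm]
        have e' : (∑ j : Fin r, if d.1 + 1 ≤ j.1 ∧ j < d then T j else 0) = 0 :=
          Finset.sum_eq_zero fun j _ => if_neg (by omega)
        simp only [e, e']
        simp only [ite_and]
        simp
      · have hlt : c < d := lt_of_le_of_ne hd (Ne.symm hdc)
        rw [sum_mul_monoWeight_of_ne _ _ _ _ _ _ _ hdc, hφ.ge d hlt]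
        simp only [ite_and, if_pos hlt, if_neg (Ne.symm hdc), pass, if_neg hlt.not_gt, add_zero,
          eq_comm (a := T c)]
        split_ifs <;> ring

theorem fusedWeight_none_none (κ : WeightKind) (t z : K) (T V : Fin r → ℕ) :
    fusedWeight κ t z none T none V = if V = T then 1 else 0 := by
  have := (fusedWeight_fromVacuum κ t z T V).vac
  simpa [funext_iff] using this

theorem fusedWeight_none_some (κ : WeightKind) (t z : K) (T V : Fin r → ℕ) (d : Fin r) :
    fusedWeight κ t z none T (some d) V =
      if ∀ j : Fin r, T j = V j + if j = d then 1 else 0 then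
        absorb κ t (V d) * t ^ (∑ j : Fin r, if j < d then T j else 0) else 0 := by
  have := (fusedWeight_fromVacuum κ t z T V).ge d (Nat.zero_le _)
  simpa using this

/-- A color absent from the top of a column can leave it on the right only if it came in from the
left. It then occupies the horizontal line throughout, so the vertical spins do not change. -/
theorem sum_mul_fusedWeight_some (κ : WeightKind) (t z : K) (T V : Fin r → ℕ) {d : Fin r}
    (hd : T d = 0) (ψ : Option (Fin r) → K) :
    ∑ x, ψ x * fusedWeight κ t z x T (some d) V =
      if V = T then z * t ^ (∑ j : Fin r, if j < d then T j else 0) * ψ (some d) else 0 := by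
  have := pathSum_induction₂
    (fun k x y => monoWeight κ t z k.rev x (T k.rev) y (V k.rev))
    (fun k x y => monoWeight κ t z k.rev x (T k.rev) y (V k.rev))
    (fun k φ _ => φ (some d) = if ∀ j : Fin r, r - k ≤ j.1 → V j = T j then
      (if r - k ≤ d.1 then z else 1) *
        t ^ (∑ j : Fin r, if r - k ≤ j.1 ∧ j < d then T j else 0) * ψ (some d) else 0)
    ψ ψ ?_ ?_
  · simpa [fusedWeight_eq_pathSum, funext_iff] using this
  · rw [if_pos (fun j hj => absurd hj (by simp)), if_neg (by simp), Finset.sum_eq_zero]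
    · simp
    · exact fun j _ => if_neg (by simp)
  · intro k φ _ hφ
    have hk : r - (k : ℕ) = (k.rev : ℕ) + 1 := by
      rw [Fin.val_rev]
      omega
    have hk' : r - ((k : ℕ) + 1) = (k.rev : ℕ) := by
      rw [Fin.val_rev]
    rw [hk] at hφ
    rw [hk']
    generalize k.rev = c at hφ ⊢
    simp only [forall_le_iff c (fun j => V j = T j)]
    rw [sum_ite_le c (fun j => j < d)]
    by_cases hdc : d = c
    · subst hdc
      have h1 : ¬ 0 = V d + 1 := by omega
      have h2 : ¬ d.1 + 1 ≤ d.1 := by omega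
      rw [sum_mul_monoWeight_self, hφ, hd]
      simp only [ite_and, if_neg h1, if_neg h2, lt_irrefl, if_false, zero_add, le_refl, if_true]
      split_ifs <;> ring
    · rw [sum_mul_monoWeight_of_ne _ _ _ _ _ _ _ hdc, hφ]
      have hne := Fin.val_ne_of_ne hdc
      rcases lt_or_gt_of_ne hdc with hlt | hgt
      · have h1 : ¬ c.1 ≤ d.1 := by omega
        have h2 : ¬ c.1 + 1 ≤ d.1 := by omega
        simp only [ite_and, pass, if_pos hlt, if_neg hlt.not_gt, if_neg h1, if_neg h2]
        split_ifs <;> ring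
      · have h1 : c.1 ≤ d.1 := by omega
        have h2 : c.1 + 1 ≤ d.1 := by omega
        simp only [ite_and, pass, if_neg hgt.not_gt, if_pos hgt, if_pos h1, if_pos h2]
        split_ifs <;> ring

/-- A row that transports its leftmost particle, of the color `d`, to the right end. -/
theorem rowWeight_leftmost (κ : WeightKind) (t z : K) {n : ℕ} (T V : Fin n → Fin r → ℕ)
    (p₀ : Fin n) (d : Fin r) (hlt : ∀ p < p₀, T p = 0) (heq : T p₀ d = 1)
    (hgt : ∀ p, p₀ < p → T p d = 0) :
    rowWeight κ t z T V none (some d) =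
      if ∀ p k, T p k = V p k + if p = p₀ ∧ k = d then 1 else 0 then
        z ^ (p₀.rev : ℕ) * t ^ (∑ p, ∑ k, if k < d then T p k else 0) else 0 := by
  let Q : Fin n → Prop := fun p => ∀ k, T p k = V p k + if p = p₀ ∧ k = d then 1 else 0
  let w : Fin n → ℕ := fun p => ∑ k, if k < d then T p k else 0
  have hsum : ∀ k : Fin n, (∑ p : Fin n, if p.1 < k.1 + 1 then w p else 0) =
      (∑ p : Fin n, if p.1 < k.1 then w p else 0) + w k := fun k => by
    have : w k = ∑ p : Fin n, if p = k then w p else 0 := by simp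
    rw [this, ← Finset.sum_add_distrib]
    refine Finset.sum_congr rfl fun p _ => ?_
    by_cases hp : p = k
    · subst hp
      simp
    · have hne := Fin.val_ne_of_ne hp
      have hiff : p.1 < k.1 + 1 ↔ p.1 < k.1 := by omega
      simp [hp, hiff]
  have hall : ∀ k : Fin n, (∀ p : Fin n, p.1 < k.1 + 1 → Q p) ↔
      Q k ∧ ∀ p : Fin n, p.1 < k.1 → Q p := fun k => by
    refine ⟨fun h => ⟨h k (by omega), fun p hp => h p (by omega)⟩, fun h p hp => ?_⟩
    rcases (Nat.lt_succ_iff.1 hp).eq_or_lt with e | e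
    · rw [Fin.ext e]
      exact h.1
    · exact h.2 p e
  have hQ : ∀ p, p ≠ p₀ → (Q p ↔ V p = T p) := fun p hp => by
    simp only [Q, hp, false_and, if_false, add_zero, funext_iff]
    exact forall_congr' fun k => eq_comm
  classical
  -- Up to the left edge of column `p₀` the row is empty, so only the vacuum component survives.
  -- Beyond `p₀` it suffices to follow the component `some d`: no later column contains `d`, so
  -- leaving with `d` forces entering with `d`.
  have := pathSum_induction (fun p x y => fusedWeight κ t z x (T p) y (V p))
    (fun q φ => (q ≤ p₀.1 → ∀ x, φ x = if x = none ∧ ∀ p : Fin n, p.1 < q → Q p then 1 else 0) ∧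
      (p₀.1 < q → φ (some d) = if ∀ p : Fin n, p.1 < q → Q p then
        z ^ (q - 1 - p₀.1) * t ^ (∑ p : Fin n, if p.1 < q then w p else 0) else 0)) none ?_ ?_
  · have h := this.2 p₀.2
    rw [rowWeight, h, Fin.val_rev]
    have e : n - 1 - p₀.1 = n - (p₀.1 + 1) := by omega
    simp only [Fin.is_lt, forall_const, if_true, e, Q, w]
  · refine ⟨fun _ x => by simp, fun h => absurd h (by omega)⟩
  · rintro k φ ⟨h₁, h₂⟩
    refine ⟨fun hk x => ?_, fun hk => ?_⟩
    · have hk' : k < p₀ := hk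
      have hT := hlt k hk'
      have hφ := h₁ (by omega)
      beta_reduce
      rw [Finset.sum_eq_single none]
      · rw [hφ, hT]
        simp only [hall, hQ k hk'.ne, hT, true_and]
        cases x with
        | none =>
          rw [fusedWeight_none_none]
          simp only [ite_and, true_and]
          split_ifs <;> simp
        | some e =>
          have hneg : ¬ ∀ j : Fin r, (0 : Fin r → ℕ) j = V k j + if j = e then 1 else 0 :=
            fun h => by simpa using h e
          rw [fusedWeight_none_some, if_neg hneg]
          simp
      · intro y _ hy
        rw [hφ, if_neg (by tauto), zero_mul]
      · simp
    · simp only [hall, hsum]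
      rcases (Nat.lt_succ_iff.1 hk).eq_or_lt with e | e
      · have hk0 : p₀ = k := Fin.ext e
        subst hk0
        have hφ := h₁ le_rfl
        have h0 : (∑ p : Fin n, if p.1 < p₀.1 then w p else 0) = 0 := by
          refine Finset.sum_eq_zero fun p _ => ?_
          split_ifs with hp
          · simp [w, hlt p hp]
          · rfl
        rw [Finset.sum_eq_single none]
        · rw [hφ, fusedWeight_none_some, h0]
          have hV : Q p₀ → V p₀ d = 0 := fun h => by
            have := h d
            simp [heq] at this
            exact this
          have hiff : (∀ j : Fin r, T p₀ j = V p₀ j + if j = d then 1 else 0) ↔ Q p₀ := by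
            simp [Q]
          simp only [hiff, true_and]
          by_cases hq : Q p₀ <;> by_cases hq' : ∀ p : Fin n, p.1 < p₀.1 → Q p <;>
            simp only [hq, hq', if_true, if_false, true_and, and_false, false_and, zero_mul,
              mul_zero, hV, absorb_zero, zero_add]
          simp [w]
        · intro y _ hy
          rw [hφ, if_neg (by tauto), zero_mul]
        · simp
      · have hk0 : p₀ < k := e
        rw [sum_mul_fusedWeight_some _ _ _ _ _ (hgt k hk0), h₂ e]
        simp only [hQ k hk0.ne', ite_and]
        have e' : k.1 + 1 - 1 - p₀.1 = (k.1 - 1 - p₀.1) + 1 := by omega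
        rw [e']
        split_ifs
        · simp only [w]
          ring
        · ring
        · rfl

end FrozenRow

/-! ### Length and reduced words -/

section Length

variable {r : ℕ}

theorem simpleRefl_mul_self (i : Fin (r - 1)) : simpleRefl i * simpleRefl i = 1 :=
  Equiv.swap_mul_self _ _

theorem simpleRefl_mul_cancel (i : Fin (r - 1)) (w : Equiv.Perm (Fin r)) :
    simpleRefl i * (simpleRefl i * w) = w := by
  rw [← mul_assoc, simpleRefl_mul_self, one_mul]

theorem simpleRefl_inv (i : Fin (r - 1)) : (simpleRefl i)⁻¹ = simpleRefl i := Equiv.swap_inv _ _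

theorem lo_ne_hi (i : Fin (r - 1)) : lo i ≠ hi i := by
  simp [lo, hi, Fin.ext_iff]

theorem val_simpleRefl (i : Fin (r - 1)) (x : Fin r) :
    (simpleRefl i x).1 = if x.1 = i.1 then i.1 + 1 else if x.1 = i.1 + 1 then i.1 else x.1 := by
  simp only [simpleRefl, Equiv.swap_apply_def, lo, hi, Fin.ext_iff]
  split_ifs <;> rfl

theorem simpleRefl_lt_simpleRefl_iff (i : Fin (r - 1)) {x y : Fin r}
    (h : ¬ (x = lo i ∧ y = hi i)) (h' : ¬ (x = hi i ∧ y = lo i)) :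
    simpleRefl i x < simpleRefl i y ↔ x < y := by
  simp only [lo, hi, Fin.ext_iff] at h h'
  rw [Fin.lt_def, Fin.lt_def, val_simpleRefl, val_simpleRefl]
  split_ifs <;> omega

theorem simpleRefl_lo (i : Fin (r - 1)) : simpleRefl i (lo i) = hi i := Equiv.swap_apply_left _ _

theorem simpleRefl_hi (i : Fin (r - 1)) : simpleRefl i (hi i) = lo i := Equiv.swap_apply_right _ _

theorem lo_lt_hi (i : Fin (r - 1)) : lo i < hi i := by
  simp [lo, hi, Fin.lt_def]

/-- A simple reflection reverses the order of the values `i`, `i + 1` only, so the pair of their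
positions is the one new inversion. -/
theorem len_simpleRefl_mul_of_lt {i : Fin (r - 1)} {w : Equiv.Perm (Fin r)}
    (h : w⁻¹ (lo i) < w⁻¹ (hi i)) : len (simpleRefl i * w) = len w + 1 := by
  unfold len
  have hnot : (w⁻¹ (lo i), w⁻¹ (hi i)) ∉
      Finset.univ.filter fun p : Fin r × Fin r => p.1 < p.2 ∧ w p.2 < w p.1 := by
    simp [(lo_lt_hi i).le]
  rw [← Finset.card_insert_of_notMem hnot]
  congr 1
  ext ⟨a, b⟩
  rw [Finset.mem_filter, Finset.mem_insert, Finset.mem_filter]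
  simp only [Finset.mem_univ, true_and, Prod.mk.injEq,
    Equiv.Perm.mul_apply, Equiv.Perm.eq_inv_iff_eq]
  by_cases h₁ : w a = lo i ∧ w b = hi i
  · have e₁ : a = w⁻¹ (lo i) := Equiv.Perm.eq_inv_iff_eq.2 h₁.1
    have e₂ : b = w⁻¹ (hi i) := Equiv.Perm.eq_inv_iff_eq.2 h₁.2
    have hab : a < b := by rwa [e₁, e₂]
    simp [h₁, simpleRefl_lo, simpleRefl_hi, lo_lt_hi, hab]
  · by_cases h₂ : w a = hi i ∧ w b = lo i
    · have e₁ : a = w⁻¹ (hi i) := Equiv.Perm.eq_inv_iff_eq.2 h₂.1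
      have e₂ : b = w⁻¹ (lo i) := Equiv.Perm.eq_inv_iff_eq.2 h₂.2
      have hab : ¬ a < b := by rw [e₁, e₂]; exact h.not_gt
      simp [h₁, hab]
    · rw [simpleRefl_lt_simpleRefl_iff i (by tauto) (by tauto)]
      simp [h₁]

theorem inv_simpleRefl_mul (i : Fin (r - 1)) (w : Equiv.Perm (Fin r)) (x : Fin r) :
    (simpleRefl i * w)⁻¹ x = w⁻¹ (simpleRefl i x) := by
  rw [mul_inv_rev, simpleRefl_inv, Equiv.Perm.mul_apply]

theorem len_simpleRefl_mul_of_gt {i : Fin (r - 1)} {w : Equiv.Perm (Fin r)}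
    (h : w⁻¹ (hi i) < w⁻¹ (lo i)) : len w = len (simpleRefl i * w) + 1 := by
  have := len_simpleRefl_mul_of_lt (i := i) (w := simpleRefl i * w) (by
    rwa [inv_simpleRefl_mul, inv_simpleRefl_mul, simpleRefl_lo, simpleRefl_hi])
  rwa [simpleRefl_mul_cancel] at this

theorem inv_lo_lt_or_gt (i : Fin (r - 1)) (w : Equiv.Perm (Fin r)) :
    w⁻¹ (lo i) < w⁻¹ (hi i) ∨ w⁻¹ (hi i) < w⁻¹ (lo i) :=
  lt_or_gt_of_ne fun h => lo_ne_hi i (w⁻¹.injective h)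

theorem len_lt_iff {i : Fin (r - 1)} {w : Equiv.Perm (Fin r)} :
    len w < len (simpleRefl i * w) ↔ w⁻¹ (lo i) < w⁻¹ (hi i) := by
  rcases inv_lo_lt_or_gt i w with h | h
  · exact iff_of_true (by rw [len_simpleRefl_mul_of_lt h]; omega) h
  · exact iff_of_false (by rw [len_simpleRefl_mul_of_gt h]; omega) h.not_gt

theorem len_one : len (1 : Equiv.Perm (Fin r)) = 0 := by
  rw [len, Finset.card_eq_zero, Finset.filter_eq_empty_iff]
  rintro p - ⟨h, h'⟩
  exact h.not_gt h'

theorem len_inv (w : Equiv.Perm (Fin r)) : len w⁻¹ = len w := by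
  unfold len
  refine Finset.card_bij' (fun p _ => (w⁻¹ p.2, w⁻¹ p.1)) (fun p _ => (w p.2, w p.1))
    ?_ ?_ ?_ ?_ <;> simp +contextual

/-- Then `w⁻¹` is strictly increasing, and a finite chain has no order automorphism but the
identity. -/
theorem eq_one_of_forall_lt {w : Equiv.Perm (Fin r)}
    (h : ∀ i : Fin (r - 1), w⁻¹ (lo i) < w⁻¹ (hi i)) : w = 1 := by
  cases r with
  | zero => exact Subsingleton.elim _ _
  | succ r =>
    have hm : StrictMono (w⁻¹ : Equiv.Perm (Fin (r + 1))) := Fin.strictMono_iff_lt_succ.2 h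
    have := Subsingleton.elim (hm.orderIsoOfSurjective _ w⁻¹.surjective) (OrderIso.refl _)
    have h' : w⁻¹ = 1 := by
      ext x
      exact congrArg Fin.val (congrArg (fun e : Fin (r + 1) ≃o Fin (r + 1) => e x) this)
    simpa using h'

theorem exists_isReducedWord (w : Equiv.Perm (Fin r)) : ∃ l, IsReducedWord w l := by
  induction hk : len w generalizing w with
  | zero =>
    have : w = 1 := eq_one_of_forall_lt fun i => by
      rcases inv_lo_lt_or_gt i w with h | h
      · exact h
      · have := len_simpleRefl_mul_of_gt h
        omega
    exact ⟨[], by simp [this], by simp [hk]⟩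
  | succ k ih =>
    by_cases h : ∀ i : Fin (r - 1), w⁻¹ (lo i) < w⁻¹ (hi i)
    · rw [eq_one_of_forall_lt h, len_one] at hk
      omega
    · push Not at h
      obtain ⟨i, hi'⟩ := h
      have hlt := (inv_lo_lt_or_gt i w).resolve_left hi'.not_gt
      have hlen := len_simpleRefl_mul_of_gt hlt
      obtain ⟨l, hl, hl'⟩ := ih (simpleRefl i * w) (by omega)
      refine ⟨i :: l, ?_, ?_⟩
      · rw [List.map_cons, List.prod_cons, hl, simpleRefl_mul_cancel]
      · rw [List.length_cons, hl', hlen]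

theorem len_prod_le (l : List (Fin (r - 1))) : len (l.map simpleRefl).prod ≤ l.length := by
  induction l with
  | nil => simp [len_one]
  | cons i l ih =>
    rw [List.map_cons, List.prod_cons, List.length_cons]
    rcases inv_lo_lt_or_gt i (l.map simpleRefl).prod with h | h
    · rw [len_simpleRefl_mul_of_lt h]
      omega
    · have := len_simpleRefl_mul_of_gt h
      omega

theorem IsReducedWord.tail {w : Equiv.Perm (Fin r)} {i : Fin (r - 1)} {l : List (Fin (r - 1))}
    (h : IsReducedWord w (i :: l)) :
    IsReducedWord (simpleRefl i * w) l ∧ len (simpleRefl i * w) < len w := by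
  obtain ⟨h₁, h₂⟩ := h
  rw [List.map_cons, List.prod_cons] at h₁
  rw [List.length_cons] at h₂
  have e : (l.map simpleRefl).prod = simpleRefl i * w := by
    rw [← h₁, simpleRefl_mul_cancel]
  have hle := len_prod_le l
  rw [e] at hle
  rcases inv_lo_lt_or_gt i w with h | h
  · have := len_simpleRefl_mul_of_lt h
    omega
  · have := len_simpleRefl_mul_of_gt h
    exact ⟨⟨e, by omega⟩, by omega⟩

end Length

/-! ### Permuting the variables -/

section PermVars

variable {R : Type*} [CommRing R] {r : ℕ}

theorem permVars_zvar (σ : Equiv.Perm (Fin r)) (i : Fin r) :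
    permVars R σ (zvar R i) = zvar R (σ i) := by
  unfold permVars zvar
  rw [IsFractionRing.ringEquivOfRingEquiv_algebraMap]
  simp

theorem permVars_param (σ : Equiv.Perm (Fin r)) (t : Rˣ) :
    permVars R σ (param r t) = param r t := by
  unfold permVars param
  rw [IsScalarTower.algebraMap_apply R (MvPolynomial (Fin r) R) (RatField R r),
    IsFractionRing.ringEquivOfRingEquiv_algebraMap]
  simp

end PermVars

/-! ### Demazure-Lusztig operators and the exchange relation -/

section Operators

variable {R : Type*} [CommRing R] [IsDomain R] {r : ℕ}

theorem zvar_ne_zero (i : Fin r) : zvar R i ≠ 0 := by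
  unfold zvar
  rw [Ne, FaithfulSMul.algebraMap_eq_zero_iff]
  exact MvPolynomial.X_ne_zero i

theorem zvar_injective : Function.Injective (zvar R : Fin r → RatField R r) := fun _ _ h =>
  MvPolynomial.X_injective (IsFractionRing.injective (MvPolynomial (Fin r) R) (RatField R r) h)

theorem param_ne_zero (t : Rˣ) : param r t ≠ 0 := by
  unfold param
  exact (t.isUnit.map _).ne_zero

theorem permVars_comp_self (i : Fin (r - 1)) (f : RatField R r) :
    permVars R (simpleRefl i) (permVars R (simpleRefl i) f) = f := by
  obtain ⟨a, b, hb, rfl⟩ := IsFractionRing.div_surjective (A := MvPolynomial (Fin r) R) f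
  have e : ∀ a : MvPolynomial (Fin r) R, permVars R (simpleRefl i) (permVars R (simpleRefl i)
      (algebraMap (MvPolynomial (Fin r) R) (RatField R r) a)) = algebraMap _ _ a := fun a => by
    unfold permVars
    rw [IsFractionRing.ringEquivOfRingEquiv_algebraMap,
      IsFractionRing.ringEquivOfRingEquiv_algebraMap]
    congr 1
    have hs : (simpleRefl i : Fin r → Fin r) ∘ simpleRefl i = id := by
      funext x
      exact Equiv.ext_iff.1 (simpleRefl_mul_self i) x
    simp [MvPolynomial.rename_rename, hs]
  rw [map_div₀, map_div₀, e, e]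

theorem permVars_zroot (i : Fin (r - 1)) :
    permVars R (simpleRefl i) (zroot R i) = (zroot R i)⁻¹ := by
  rw [zroot, map_div₀, permVars_zvar, permVars_zvar, simpleRefl_lo, simpleRefl_hi, inv_div]

theorem zroot_sub_one_ne_zero (i : Fin (r - 1)) : zroot R i - 1 ≠ 0 := by
  rw [zroot, Ne, sub_eq_zero, div_eq_one_iff_eq (zvar_ne_zero _)]
  exact fun h => lo_ne_hi i (zvar_injective h)

theorem zroot_ne_zero (i : Fin (r - 1)) : zroot R i ≠ 0 :=
  div_ne_zero (zvar_ne_zero _) (zvar_ne_zero _)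

theorem demLusInv_demLus (t : Rˣ) (i : Fin (r - 1)) (f : RatField R r) :
    demLusInv t i (demLus t i f) = f := by
  have h0 := param_ne_zero (r := r) t
  have h1 := zroot_ne_zero (R := R) i
  have h2 := zroot_sub_one_ne_zero (R := R) i
  have h3 : 1 - zroot R i ≠ 0 := fun h => h2 (by linear_combination -h)
  simp only [demLusInv, demLus, map_sub, map_div₀, map_mul, permVars_comp_self, permVars_zroot,
    permVars_param, map_one]
  generalize permVars R (simpleRefl i) f = g
  generalize zroot R i = x at *
  generalize param r t = q at *
  field_simp
  ring

/-- The exchange relation of two functions, in terms of the operator `𝓛_{i,t}`. -/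
theorem eq_demLus_of_exchange (t : Rˣ) (i : Fin (r - 1)) {f g : RatField R r}
    (h : (zvar R (lo i) - zvar R (hi i)) * g = (1 - param r t) * zvar R (hi i) * f +
      (param r t * zvar R (lo i) - zvar R (hi i)) * permVars R (simpleRefl i) f) :
    g = demLus t i f := by
  have h0 := zvar_ne_zero (R := R) (hi i)
  have h1 : zvar R (lo i) - zvar R (hi i) ≠ 0 :=
    sub_ne_zero.2 fun h => lo_ne_hi i (zvar_injective h)
  have h2 := zroot_sub_one_ne_zero (R := R) i
  unfold demLus
  unfold zroot at h2 ⊢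
  generalize permVars R (simpleRefl i) f = f' at *
  generalize param r t = q at *
  refine mul_left_cancel₀ h1 ?_
  rw [h]
  field_simp
  ring

end Operators

/-! ### Weights under ring homomorphisms, and their support -/

section Transfer

variable {K : Type*} [CommRing K] {L : Type*} [CommRing L] {r : ℕ}

theorem map_monoWeight (φ : K →+* L) (κ : WeightKind) (t z : K) (c : Fin r) (a : Option (Fin r))
    (n : ℕ) (b : Option (Fin r)) (m : ℕ) :
    φ (monoWeight κ t z c a n b m) = monoWeight κ (φ t) (φ z) c a n b m := by
  rcases a with _ | a <;> rcases b with _ | b <;> cases κ <;> simp only [monoWeight] <;>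
    split_ifs <;> simp

theorem map_fusedWeight (φ : K →+* L) (κ : WeightKind) (t z : K) (a : Option (Fin r))
    (T : Fin r → ℕ) (b : Option (Fin r)) (V : Fin r → ℕ) :
    φ (fusedWeight κ t z a T b V) = fusedWeight κ (φ t) (φ z) a T b V := by
  simp only [fusedWeight, map_sum, apply_ite φ, map_prod, map_monoWeight, map_zero]

theorem monoWeight_mem (S : Subring K) (κ : WeightKind) {t z : K} (ht : t ∈ S) (hz : z ∈ S)
    (c : Fin r) (a : Option (Fin r)) (n : ℕ) (b : Option (Fin r)) (m : ℕ) :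
    monoWeight κ t z c a n b m ∈ S := by
  have := map_monoWeight S.subtype κ ⟨t, ht⟩ ⟨z, hz⟩ c a n b m
  rw [← show S.subtype ⟨t, ht⟩ = t from rfl, ← show S.subtype ⟨z, hz⟩ = z from rfl, ← this]
  exact Subtype.property _

theorem monoWeight_eq_zero (κ : WeightKind) (t z : K) (c : Fin r) (a : Option (Fin r))
    {n : ℕ} (b : Option (Fin r)) {m : ℕ} (h : n + 1 < m) : monoWeight κ t z c a n b m = 0 := by
  have h1 : m ≠ n := by omega
  have h2 : m ≠ n + 1 := by omega
  have h3 : n ≠ m + 1 := by omega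
  rcases a with _ | a <;> rcases b with _ | b <;> simp [monoWeight, h1, h2, h3]

theorem fusedWeight_eq_zero (κ : WeightKind) (t z : K) (a : Option (Fin r))
    {T : Fin r → ℕ} (b : Option (Fin r)) {V : Fin r → ℕ} (k : Fin r) (h : T k + 1 < V k) :
    fusedWeight κ t z a T b V = 0 := by
  refine Finset.sum_eq_zero fun g _ => ?_
  rw [Finset.prod_eq_zero (Finset.mem_univ k.rev), ite_self]
  rw [Fin.rev_rev]
  exact monoWeight_eq_zero _ _ _ _ _ _ h

end Transfer

/-! ### Exchange of two adjacent rows in the full system -/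

section Rows

variable {K : Type*} [Field K] {L : Type*} [Field L] {r n : ℕ}

theorem map_rowWeight (φ : K →+* L) (κ : WeightKind) (t z : K) (T V : Fin n → Fin r → ℕ)
    (a b : Option (Fin r)) :
    φ (rowWeight κ t z T V a b) = rowWeight κ (φ t) (φ z) T V a b := by
  simp only [rowWeight, pathSum, map_sum, apply_ite φ, map_prod, map_fusedWeight, map_zero]

theorem le_of_rowWeight_ne_zero {κ : WeightKind} {t z : K} {T V : Fin n → Fin r → ℕ}
    {a b : Option (Fin r)} (h : rowWeight κ t z T V a b ≠ 0) (p : Fin n) (k : Fin r) :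
    V p k ≤ T p k + 1 := by
  by_contra hlt
  refine h (Finset.sum_eq_zero fun g _ => ?_)
  rw [Finset.prod_eq_zero (Finset.mem_univ p), ite_self]
  exact fusedWeight_eq_zero _ _ _ _ _ k (by omega)

/-- Multiplicities grow by at most one in each row. -/
theorem ver_le {ver : Fin (r + 1) → Fin n → Fin r → ℕ} {m : ℕ} {p : Fin n} {c : Fin r}
    (h : ∀ k : Fin r, k.1 < m → ver k.succ p c ≤ ver k.castSucc p c + 1) (j : Fin (r + 1))
    (hj : j.1 ≤ m) : ver j p c ≤ ver 0 p c + j := by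
  induction j using Fin.induction with
  | zero => simp
  | succ j ih =>
    have h1 := h j (by simpa using hj)
    have h2 := ih (by simp at hj ⊢; omega)
    simp only [Fin.val_succ, Fin.val_castSucc] at *
    omega

/-- The partition function as a sum over the vertical spins. -/
def rowsSum (κ : WeightKind) (t : K) (z : Fin r → K) (D : Finset ℕ) (T : Fin n → Fin r → ℕ)
    (d : Fin r → Fin r) : K :=
  ∑ ver ∈ Fintype.piFinset (fun _ : Fin (r + 1) => configs r n D),
    if ver 0 = T ∧ ver (Fin.last r) = 0 then
      ∏ i, rowWeight κ t (z i) (ver i.castSucc) (ver i.succ) none (some (d i)) else 0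

theorem map_rowsSum (φ : K →+* L) (κ : WeightKind) (t : K) (z : Fin r → K) (D : Finset ℕ)
    (T : Fin n → Fin r → ℕ) (d : Fin r → Fin r) :
    φ (rowsSum κ t z D T d) = rowsSum κ (φ t) (fun i => φ (z i)) D T d := by
  simp only [rowsSum, map_sum, apply_ite φ, map_prod, map_rowWeight, map_zero]

theorem rowsSum_mem (S : Subring K) (κ : WeightKind) {t : K} (ht : t ∈ S) {z : Fin r → K}
    (hz : ∀ i, z i ∈ S) (D : Finset ℕ) (T : Fin n → Fin r → ℕ) (d : Fin r → Fin r) :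
    rowsSum κ t z D T d ∈ S := by
  have hite : ∀ (p : Prop) [Decidable p] (x : K), x ∈ S → (if p then x else 0) ∈ S := by
    intro p _ x hx
    split_ifs
    · exact hx
    · exact S.zero_mem
  exact sum_mem fun ver _ => hite _ _ <| prod_mem fun i _ => sum_mem fun g _ => hite _ _ <|
    prod_mem fun p _ => sum_mem fun g' _ => hite _ _ <| prod_mem fun k _ =>
      monoWeight_mem S κ ht (hz i) _ _ _ _ _

/-- The sum is split into fibers along which only coordinate `j` varies. This localizes an identity
to the vertical spins between two rows. -/
theorem sum_piFinset_eq_zero {ι V M : Type*} [Fintype ι] [DecidableEq ι] [DecidableEq V]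
    [AddCommMonoid M] (E : Finset V) (G : (ι → V) → M) (j : ι)
    (h : ∀ g : ι → V, ∑ v ∈ E, G (Function.update g j v) = 0) :
    ∑ g ∈ Fintype.piFinset (fun _ : ι => E), G g = 0 := by
  rcases E.eq_empty_or_nonempty with rfl | ⟨v₀, hv₀⟩
  · rw [Finset.sum_eq_zero]
    intro g hg
    exact absurd (Fintype.mem_piFinset.1 hg j) (Finset.notMem_empty _)
  rw [← Finset.sum_fiberwise_of_maps_to
    (t := (Fintype.piFinset fun _ : ι => E).image fun g => Function.update g j v₀)
    (g := fun g => Function.update g j v₀) (fun g hg => Finset.mem_image_of_mem _ hg)]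
  refine Finset.sum_eq_zero fun g₀ hg₀ => ?_
  obtain ⟨g₁, hg₁, rfl⟩ := Finset.mem_image.1 hg₀
  rw [← h g₁]
  refine Finset.sum_bij' (fun g _ => g j) (fun v _ => Function.update g₁ j v) ?_ ?_ ?_ ?_ ?_
  · intro g hg
    exact Fintype.mem_piFinset.1 (Finset.mem_filter.1 hg).1 j
  · intro v hv
    refine Finset.mem_filter.2 ⟨Fintype.mem_piFinset.2 fun i => ?_, by simp⟩
    by_cases hi : i = j
    · subst hi
      simpa using hv
    · rw [Function.update_of_ne hi]
      exact Fintype.mem_piFinset.1 hg₁ i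
  · intro g hg
    have e := (Finset.mem_filter.1 hg).2
    funext i
    by_cases hi : i = j
    · subst hi
      simp
    · have := congrFun e i
      simp only [Function.update_of_ne hi] at this ⊢
      exact this.symm
  · intro v _
    simp
  · intro g hg
    have e := (Finset.mem_filter.1 hg).2
    congr 1
    funext i
    by_cases hi : i = j
    · subst hi
      simp
    · have := congrFun e i
      simp only [Function.update_of_ne hi] at this ⊢
      exact this

/-- The exchange relation for the right boundary spins of two adjacent rows. -/
theorem rowsSum_exchange (κ : WeightKind) (t : K) {z : Fin r → K} (T : Fin n → Fin r → ℕ)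
    (hT : ∀ p k, T p k ≤ r) (d : Fin r → Fin r) (i : Fin (r - 1)) (hz : z (lo i) ≠ z (hi i))
    (hd : d (lo i) < d (hi i)) :
    (z (lo i) - z (hi i)) *
        rowsSum κ t z (Finset.range (2 * r + 1)) T (fun j => d (simpleRefl i j)) =
      (1 - t) * z (hi i) * rowsSum κ t z (Finset.range (2 * r + 1)) T d +
      (t * z (lo i) - z (hi i)) *
        rowsSum κ t (fun j => z (simpleRefl i j)) (Finset.range (2 * r + 1)) T d := by
  set D := Finset.range (2 * r + 1) with hDdef
  rw [← sub_eq_zero]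
  simp only [rowsSum, Finset.mul_sum, ← Finset.sum_add_distrib, ← Finset.sum_sub_distrib]
  -- The identity already holds after summing over the vertical spins between rows `i` and `i + 1`,
  -- with all others fixed.
  refine sum_piFinset_eq_zero _ _ (hi i).castSucc fun ver => ?_
  have hj0 : (0 : Fin (r + 1)) ≠ (hi i).castSucc := by simp [Fin.ext_iff, hi]
  have hjl : Fin.last r ≠ (hi i).castSucc := Fin.ne_of_val_ne (hi i).2.ne'
  simp only [Function.update_of_ne hj0, Function.update_of_ne hjl]
  by_cases hb : ver 0 = T ∧ ver (Fin.last r) = 0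
  swap
  · simp [hb]
  simp only [if_pos hb]
  let rest : K := ∏ k ∈ Finset.univ \ {lo i, hi i},
    rowWeight κ t (z k) (ver k.castSucc) (ver k.succ) none (some (d k))
  have hlo : (lo i).castSucc ≠ (hi i).castSucc := by simp [Fin.ext_iff, lo, hi]
  have hhi : (hi i).succ ≠ (hi i).castSucc := by simp [Fin.ext_iff]
  have hlos : (lo i).succ = (hi i).castSucc := by simp [lo, hi]
  have split : ∀ (z' : Fin r → K) (d' : Fin r → Fin r) (V : Fin n → Fin r → ℕ),
      (∀ k, k ≠ lo i → k ≠ hi i → z' k = z k ∧ d' k = d k) →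
      ∏ k, rowWeight κ t (z' k) (Function.update ver (hi i).castSucc V k.castSucc)
        (Function.update ver (hi i).castSucc V k.succ) none (some (d' k)) =
      rest * (rowWeight κ t (z' (lo i)) (ver (lo i).castSucc) V none (some (d' (lo i))) *
        rowWeight κ t (z' (hi i)) V (ver (hi i).succ) none (some (d' (hi i)))) := by
    intro z' d' V h
    rw [← Finset.prod_sdiff (Finset.subset_univ {lo i, hi i}), Finset.prod_pair (lo_ne_hi i)]
    congr 1
    · refine Finset.prod_congr rfl fun k hk => ?_
      simp only [Finset.mem_sdiff, Finset.mem_univ, true_and, Finset.mem_insert,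
        Finset.mem_singleton, not_or] at hk
      have h1 : k.castSucc ≠ (hi i).castSucc := fun e => hk.2 (Fin.castSucc_injective _ e)
      have h2 : k.succ ≠ (hi i).castSucc := fun e =>
        hk.1 (Fin.succ_injective _ (e.trans hlos.symm))
      rw [Function.update_of_ne h1, Function.update_of_ne h2, (h k hk.1 hk.2).1,
        (h k hk.1 hk.2).2]
    · rw [hlos, Function.update_self, Function.update_of_ne hlo, Function.update_of_ne hhi]
  have hs : ∀ k, k ≠ lo i → k ≠ hi i → simpleRefl i k = k := fun k h h' =>
    Equiv.swap_apply_of_ne_of_ne h h'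
  have e₁ := fun V => split z (fun j => d (simpleRefl i j)) V
    fun k h h' => ⟨rfl, by rw [hs k h h']⟩
  have e₂ := fun V => split z d V fun k h h' => ⟨rfl, rfl⟩
  have e₃ := fun V => split (fun j => z (simpleRefl i j)) d V
    fun k h h' => ⟨by rw [hs k h h'], rfl⟩
  simp only [simpleRefl_lo, simpleRefl_hi] at e₁ e₃
  simp only [e₁, e₂, e₃]
  by_cases hrest : rest = 0
  · simp [hrest]
  -- Since `rest` is nonzero, the rows above have nonzero weight. This bounds the multiplicities
  -- entering row `i`, so `D` contains all values needed below them.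
  have hD : ∀ p k, ∀ v ≤ ver (lo i).castSucc p k + 1, v ∈ D := by
    intro p k v hv
    have hle := ver_le (ver := ver) (m := i) (p := p) (c := k) (fun j hj => by
      refine le_of_rowWeight_ne_zero (Finset.prod_ne_zero_iff.1 hrest j ?_) p k
      simp only [Finset.mem_sdiff, Finset.mem_univ, true_and, Finset.mem_insert,
        Finset.mem_singleton, not_or, Fin.ext_iff, lo, hi]
      omega) (lo i).castSucc le_rfl
    rw [hb.1] at hle
    have h1 := hT p k
    have h2 := i.2
    have h3 : ((lo i).castSucc : Fin (r + 1)).1 = i.1 := rfl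
    rw [hDdef, Finset.mem_range]
    omega
  have := rowWeight_exchange (t := t) hz κ (ver (lo i).castSucc) (ver (hi i).succ) hD hd
  rw [Finset.sum_sub_distrib, Finset.sum_add_distrib]
  simp only [← Finset.mul_sum]
  linear_combination rest * this

end Rows

/-! ### From states to sums over vertical spins -/

section States

variable {K : Type*} [Field K] {r n : ℕ} {μ : Fin r → ℤ} {c d : Fin r → Fin r} {M : ℤ}

theorem topSpin_le (μ : Fin r → ℤ) (c : Fin r → Fin r) (j : ℤ) (k : Fin r) :
    topSpin μ c j k ≤ r := by
  refine (Finset.card_filter_le (Finset.univ : Finset (Fin r)) _).trans ?_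
  simp

/-- The spins of a state. -/
def State.spins (s : State μ c d M n) :
    (Fin r → Fin (n + 1) → Option (Fin r)) × (Fin (r + 1) → Fin n → Fin r → ℕ) :=
  (s.hor, s.ver)

theorem State.spins_injective :
    Function.Injective (State.spins : State μ c d M n → _) := fun s s' h => by
  rw [State.ext_iff]
  exact Prod.ext_iff.1 h

/-- Multiplicities are at most `r` at the top and grow by at most one in each of the `r` rows,
whence the bound `2 * r`. -/
theorem State.ver_mem {κ : WeightKind} {t : K} {z : Fin r → K} {s : State μ c d M n}
    (h : s.weight κ t z ≠ 0) :
    s.ver ∈ Fintype.piFinset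
      (fun _ : Fin (r + 1) => configs r n (Finset.range (2 * r + 1))) := by
  refine Fintype.mem_piFinset.2 fun j => mem_configs.2 fun p k => ?_
  have hle := ver_le (ver := s.ver) (m := r) (p := p) (c := k) (fun i _ => by
    by_contra hlt
    refine Finset.prod_ne_zero_iff.1 (Finset.prod_ne_zero_iff.1 h i (Finset.mem_univ _)) p
      (Finset.mem_univ _) ?_
    exact fusedWeight_eq_zero _ _ _ _ _ k (by omega)) j (by omega)
  rw [s.ver_top] at hle
  have := topSpin_le μ c (M + (p.rev : ℤ)) k
  rw [Finset.mem_range]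
  omega

theorem State.finite_weight_ne_zero (κ : WeightKind) (t : K) (z : Fin r → K) :
    {s : State μ c d M n | s.weight κ t z ≠ 0}.Finite := by
  refine Set.Finite.subset (Set.Finite.preimage (State.spins_injective.injOn)
    (((Finset.univ : Finset (Fin r → Fin (n + 1) → Option (Fin r))) ×ˢ Fintype.piFinset
      (fun _ : Fin (r + 1) => configs r n (Finset.range (2 * r + 1)))).finite_toSet)) ?_
  intro s hs
  exact Finset.mem_coe.2 (Finset.mem_product.2 ⟨Finset.mem_univ _, State.ver_mem hs⟩)

/-- For fixed vertical spins the horizontal spins of different rows are independent, and summing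
over them gives the row weights. -/
theorem finsum_weight_eq_rowsSum (κ : WeightKind) (t : K) (z : Fin r → K) :
    ∑ᶠ s : State μ c d M n, s.weight κ t z =
      rowsSum κ t z (Finset.range (2 * r + 1))
        (fun p : Fin n => topSpin μ c (M + (p.rev : ℤ))) d := by
  have hfin := State.finite_weight_ne_zero (μ := μ) (c := c) (d := d) (M := M) (n := n) κ t z
  rw [finsum_eq_sum_of_support_subset (s := hfin.toFinset) _ (by
    intro s hs
    simpa using hs)]
  have hrow : rowsSum κ t z (Finset.range (2 * r + 1))
        (fun p : Fin n => topSpin μ c (M + (p.rev : ℤ))) d =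
      ∑ x ∈ (Finset.univ : Finset (Fin r → Fin (n + 1) → Option (Fin r))) ×ˢ Fintype.piFinset
        (fun _ : Fin (r + 1) => configs r n (Finset.range (2 * r + 1))),
        if (x.2 0 = (fun p : Fin n => topSpin μ c (M + (p.rev : ℤ))) ∧ x.2 (Fin.last r) = 0) ∧
            ∀ i, x.1 i 0 = none ∧ x.1 i (Fin.last n) = some (d i) then
          ∏ i : Fin r, ∏ p : Fin n, fusedWeight κ t (z i) (x.1 i p.castSucc) (x.2 i.castSucc p)
            (x.1 i p.succ) (x.2 i.succ p) else 0 := by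
    rw [Finset.sum_product_right]
    refine Finset.sum_congr rfl fun ver _ => ?_
    simp only [rowWeight, pathSum, Finset.prod_univ_sum, Fintype.piFinset_univ,
      Finset.prod_ite_zero, Finset.mem_univ, true_imp_iff]
    split_ifs with h
    · refine Finset.sum_congr rfl fun hor _ => ?_
      simp [h]
    · refine (Finset.sum_eq_zero fun hor _ => if_neg fun h' => h h'.1).symm
  rw [hrow]
  refine Finset.sum_of_injOn State.spins State.spins_injective.injOn ?_ ?_ ?_
  · intro s hs
    have hs' : s.weight κ t z ≠ 0 := by simpa using hs
    exact Finset.mem_coe.2 (Finset.mem_product.2 ⟨Finset.mem_univ _, State.ver_mem hs'⟩)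
  · rintro ⟨hor, ver⟩ _ hx
    split_ifs with h
    · by_contra hne
      refine hx ⟨⟨hor, ver, fun i => (h.2 i).1, fun i => (h.2 i).2, congrFun h.1.1,
        congrFun h.1.2⟩, ?_, rfl⟩
      simpa [State.weight] using hne
    · rfl
  · intro s _
    rw [if_pos ⟨⟨funext s.ver_top, funext s.ver_bottom⟩, fun i => ⟨s.hor_left i, s.hor_right i⟩⟩]
    rfl

end States

/-! ### The frozen state for equal flags -/

section Frozen

variable {K : Type*} [Field K] {r n : ℕ}

/-- The vertical spins above row `i` of the state in which each row transports its leftmost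
particle to the right end. -/
def frozenSpin (μ : Fin r → ℤ) (c : Fin r → Fin r) (M : ℤ) (i : ℕ) (p : Fin n) (k : Fin r) : ℕ :=
  ∑ j : Fin r, if i ≤ j.1 ∧ (μ j = M + (p.rev : ℤ) ∧ c j = k) then 1 else 0

variable {μ : Fin r → ℤ} {c : Fin r → Fin r} {M : ℤ}

theorem frozenSpin_zero : frozenSpin (n := n) μ c M 0 =
    fun p : Fin n => topSpin μ c (M + (p.rev : ℤ)) := by
  funext p k
  rw [frozenSpin, topSpin, Finset.card_filter]
  simp only [Nat.zero_le, true_and]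

theorem frozenSpin_last : frozenSpin (n := n) μ c M r = 0 := by
  funext p k
  exact Finset.sum_eq_zero fun j _ => if_neg (by omega)

theorem frozenSpin_le (i : ℕ) (p : Fin n) (k : Fin r) : frozenSpin μ c M i p k ≤ r := by
  refine (Finset.sum_le_sum fun j _ => (?_ : _ ≤ 1)).trans (by simp)
  split_ifs <;> omega

theorem frozenSpin_succ (i : Fin r) (p : Fin n) (k : Fin r) :
    frozenSpin μ c M i p k =
      frozenSpin μ c M (i + 1) p k + if μ i = M + (p.rev : ℤ) ∧ c i = k then 1 else 0 := by
  rw [frozenSpin, sum_ite_le i (fun j => μ j = M + (p.rev : ℤ) ∧ c j = k) (fun _ => 1), add_comm]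
  rfl

/-- As `μ` is decreasing, no remaining particle lies to the left of particle `i`. The exponent of
`z` counts the columns to its right, that of `t` the remaining particles of larger color, all of
which it passes. -/
theorem rowWeight_frozenSpin (κ : WeightKind) (t z : K) (hμ : Antitone μ) (hM : ∀ i, M ≤ μ i)
    (hn : ∀ i, μ i < M + n) (hc : Function.Injective c) (i : Fin r) (V : Fin n → Fin r → ℕ) :
    rowWeight κ t z (frozenSpin μ c M i) V none (some (c i)) =
      if V = frozenSpin μ c M (i + 1) then
        z ^ (μ i - M).toNat * t ^ (∑ j : Fin r, if i ≤ j ∧ c j < c i then 1 else 0) else 0 := by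
  have hpos : ∀ j, (μ j - M).toNat < n := fun j => by have := hM j; have := hn j; omega
  let pos : Fin r → Fin n := fun j => Fin.rev ⟨(μ j - M).toNat, hpos j⟩
  have hrev : ∀ j, ((pos j).rev : ℕ) = (μ j - M).toNat := fun j => by simp [pos]
  have hiff : ∀ (j : Fin r) (p : Fin n), μ j = M + (p.rev : ℤ) ↔ p = pos j := fun j p => by
    have h1 := hM j
    have h2 := hn j
    rw [← Fin.rev_inj, Fin.ext_iff, hrev]
    omega
  rw [rowWeight_leftmost κ t z _ V (pos i) (c i), hrev]
  · have e : (∀ p k, frozenSpin μ c M i p k = V p k + if p = pos i ∧ k = c i then 1 else 0) ↔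
        V = frozenSpin μ c M (i + 1) := by
      simp only [frozenSpin_succ, hiff, eq_comm (a := c i), add_left_inj, funext_iff]
      exact forall_congr' fun p => forall_congr' fun k => eq_comm
    have e' : (∑ p : Fin n, ∑ k, if k < c i then frozenSpin μ c M i p k else 0) =
        ∑ j : Fin r, if i ≤ j ∧ c j < c i then 1 else 0 := by
      have : ∀ (p : Fin n) (k : Fin r), (if k < c i then frozenSpin μ c M i p k else 0) =
          ∑ j : Fin r, if p = pos j then
            (if c j = k then (if i ≤ j ∧ c j < c i then 1 else 0) else 0) else 0 := by
        intro p k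
        simp only [frozenSpin, hiff]
        by_cases hk : k < c i
        · rw [if_pos hk]
          refine Finset.sum_congr rfl fun j _ => ?_
          simp only [← ite_and]
          refine if_congr ⟨fun h => ⟨h.2.1, h.2.2, h.1, h.2.2 ▸ hk⟩,
            fun h => ⟨h.2.2.1, h.1, h.2.1⟩⟩ rfl rfl
        · rw [if_neg hk]
          refine (Finset.sum_eq_zero fun j _ => ?_).symm
          simp only [← ite_and]
          refine if_neg ?_
          rintro ⟨-, h, -, h'⟩
          exact hk (h ▸ h')
      simp only [this]
      calc _ = ∑ p : Fin n, ∑ j : Fin r, ∑ k, if p = pos j then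
            (if c j = k then (if i ≤ j ∧ c j < c i then 1 else 0) else 0) else 0 :=
          Finset.sum_congr rfl fun p _ => Finset.sum_comm
        _ = ∑ j : Fin r, ∑ p : Fin n, ∑ k, if p = pos j then
            (if c j = k then (if i ≤ j ∧ c j < c i then 1 else 0) else 0) else 0 :=
          Finset.sum_comm
        _ = _ := by
          refine Finset.sum_congr rfl fun j _ => ?_
          rw [Finset.sum_eq_single (pos j)]
          · simp
          · intro p _ hp
            simp [hp]
          · simp
    simp only [e, e']
  · intro p hp
    funext k
    refine Finset.sum_eq_zero fun j _ => if_neg ?_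
    rintro ⟨hij, h, -⟩
    rw [hiff] at h
    have h1 : μ j ≤ μ i := hμ hij
    have h2 : (pos j).rev ≤ (pos i).rev := by
      rw [Fin.le_def, hrev, hrev]
      omega
    rw [Fin.rev_le_rev] at h2
    exact (h ▸ hp).not_ge h2
  · rw [frozenSpin, Finset.sum_eq_single i]
    · simp only [hiff]
      simp
    · exact fun j _ hj => if_neg fun h => hj (hc h.2.2)
    · simp
  · intro p hp
    refine Finset.sum_eq_zero fun j _ => if_neg ?_
    rintro ⟨-, h, h'⟩
    rw [hiff, hc h'] at h
    exact hp.ne' h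

/-- If the flags at the top and on the right agree, only one state contributes. -/
theorem rowsSum_frozen (κ : WeightKind) (t : K) (z : Fin r → K) (hμ : Antitone μ)
    (hM : ∀ i, M ≤ μ i) (hn : ∀ i, μ i < M + n) (hc : Function.Injective c) :
    rowsSum κ t z (Finset.range (2 * r + 1))
        (fun p : Fin n => topSpin μ c (M + (p.rev : ℤ))) c =
      t ^ (∑ i : Fin r, ∑ j : Fin r, if i ≤ j ∧ c j < c i then 1 else 0) *
        ∏ i, z i ^ (μ i - M).toNat := by
  rw [rowsSum, Finset.sum_eq_single fun j : Fin (r + 1) => frozenSpin μ c M j]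
  · rw [if_pos ⟨frozenSpin_zero, frozenSpin_last⟩, ← Finset.prod_pow_eq_pow_sum, mul_comm,
      ← Finset.prod_mul_distrib]
    refine Finset.prod_congr rfl fun i _ => ?_
    have := rowWeight_frozenSpin κ t (z i) hμ hM hn hc i (frozenSpin μ c M (i + 1))
    rw [if_pos rfl] at this
    exact this
  · intro ver _ hver
    by_contra hne
    have hb := (ite_ne_right_iff.1 hne).1
    rw [if_pos hb, ← Ne, Finset.prod_ne_zero_iff] at hne
    refine hver (funext fun j => ?_)
    -- From the top down: the spins above a row of nonzero weight determine those below it.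
    induction j using Fin.induction with
    | zero => exact hb.1.trans frozenSpin_zero.symm
    | succ j ih =>
      have := hne j (Finset.mem_univ _)
      rw [ih, Fin.val_castSucc, rowWeight_frozenSpin κ t (z j) hμ hM hn hc] at this
      exact (ite_ne_right_iff.1 this).1
  · intro h
    refine absurd (Fintype.mem_piFinset.2 fun j => mem_configs.2 fun p k => ?_) h
    have := frozenSpin_le (μ := μ) (c := c) (M := M) j.1 p k
    rw [Finset.mem_range]
    omega

end Frozen

/-! ### Recursion, base case and uniqueness -/

section PartitionFunction

variable {R : Type*} [CommRing R] [IsDomain R] {r n : ℕ}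

theorem partitionFunction_eq (κ : WeightKind) (t : Rˣ) (μ : Fin r → ℤ) (c d : Fin r → Fin r)
    (M : ℤ) (n : ℕ) :
    partitionFunction κ t μ c d M n = (∏ i : Fin r, zvar R i) ^ M *
      rowsSum κ (param r t) (zvar R) (Finset.range (2 * r + 1))
        (fun p : Fin n => topSpin μ c (M + (p.rev : ℤ))) d := by
  rw [partitionFunction, finsum_weight_eq_rowsSum]

theorem partitionFunction_mem_laurent (κ : WeightKind) (t : Rˣ) (μ : Fin r → ℤ)
    (c d : Fin r → Fin r) (M : ℤ) (n : ℕ) :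
    partitionFunction κ t μ c d M n ∈ laurent R r := by
  rw [partitionFunction_eq]
  have hz : ∀ i : Fin r, zvar R i ∈ laurent R r := fun i =>
    Algebra.subset_adjoin (Or.inl ⟨i, rfl⟩)
  have hz' : ∀ i : Fin r, (zvar R i)⁻¹ ∈ laurent R r := fun i =>
    Algebra.subset_adjoin (Or.inr ⟨i, rfl⟩)
  refine mul_mem ?_ (rowsSum_mem (laurent R r).toSubring κ
    (Subalgebra.algebraMap_mem _ _) hz _ _ _)
  rw [← Finset.prod_zpow]
  refine prod_mem fun i _ => ?_
  cases M with
  | ofNat m =>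
    rw [Int.ofNat_eq_natCast, zpow_natCast]
    exact pow_mem (hz i) m
  | negSucc m =>
    rw [zpow_negSucc, ← inv_pow]
    exact pow_mem (hz' i) _

/-- The prefactor is symmetric and `t` is fixed, so only the assignment of spectral parameters to
rows changes. -/
theorem permVars_partitionFunction (κ : WeightKind) (t : Rˣ) (μ : Fin r → ℤ)
    (c d : Fin r → Fin r) (M : ℤ) (n : ℕ) (σ : Equiv.Perm (Fin r)) :
    permVars R σ (partitionFunction κ t μ c d M n) = (∏ i : Fin r, zvar R i) ^ M *
      rowsSum κ (param r t) (fun i => zvar R (σ i)) (Finset.range (2 * r + 1))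
        (fun p : Fin n => topSpin μ c (M + (p.rev : ℤ))) d := by
  have h := map_rowsSum (permVars R σ).toRingHom κ (param r t) (zvar R)
    (Finset.range (2 * r + 1)) (fun p : Fin n => topSpin μ c (M + (p.rev : ℤ))) d
  simp only [RingEquiv.toRingHom_eq_coe, RingHom.coe_coe, permVars_param, permVars_zvar] at h
  rw [partitionFunction_eq, map_mul, map_zpow₀, map_prod, h]
  simp only [permVars_zvar, Equiv.prod_comp σ (zvar R)]

theorem partitionFunction_up (κ : WeightKind) (t : Rˣ) (μ : Fin r → ℤ) (c : Fin r → Fin r)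
    (M : ℤ) (n : ℕ) (i : Fin (r - 1)) (w : Equiv.Perm (Fin r))
    (h : len w < len (simpleRefl i * w)) :
    partitionFunction κ t μ c (flag (simpleRefl i * w)) M n =
      demLus t i (partitionFunction κ t μ c (flag w) M n) := by
  refine eq_demLus_of_exchange t i ?_
  have hz : zvar R (lo i) ≠ zvar R (hi i) := fun h => lo_ne_hi i (zvar_injective h)
  have hflag : flag (simpleRefl i * w) = fun j => flag w (simpleRefl i j) :=
    funext fun j => inv_simpleRefl_mul i w j
  have := rowsSum_exchange κ (param r t) (fun p : Fin n => topSpin μ c (M + (p.rev : ℤ)))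
    (fun p k => topSpin_le μ c _ k) (flag w) i hz (len_lt_iff.1 h)
  rw [permVars_partitionFunction, partitionFunction_eq, partitionFunction_eq, hflag]
  linear_combination (∏ i : Fin r, zvar R i) ^ M * this

theorem partitionFunction_down (κ : WeightKind) (t : Rˣ) (μ : Fin r → ℤ) (c : Fin r → Fin r)
    (M : ℤ) (n : ℕ) (i : Fin (r - 1)) (w : Equiv.Perm (Fin r))
    (h : len (simpleRefl i * w) < len w) :
    partitionFunction κ t μ c (flag (simpleRefl i * w)) M n =
      demLusInv t i (partitionFunction κ t μ c (flag w) M n) := by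
  have := partitionFunction_up κ t μ c M n i (simpleRefl i * w) (by rwa [simpleRefl_mul_cancel])
  rw [simpleRefl_mul_cancel] at this
  rw [this, demLusInv_demLus]

/-- The exponent of `t` in the frozen weight counts the inversions of `w⁻¹`, which are as many as
those of `w`; the terms with `i = j` vanish. -/
theorem len_eq_sum (w : Equiv.Perm (Fin r)) :
    len w = ∑ i : Fin r, ∑ j : Fin r, if i ≤ j ∧ flag w j < flag w i then 1 else 0 := by
  rw [← len_inv, len, Finset.card_filter, Fintype.sum_prod_type]
  refine Finset.sum_congr rfl fun i _ => Finset.sum_congr rfl fun j _ => if_congr ?_ rfl rfl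
  refine and_congr_left fun h => ⟨le_of_lt, fun hle => lt_of_le_of_ne hle ?_⟩
  intro e
  dsimp only at e h
  rw [e] at h
  exact lt_irrefl _ h

theorem flag_injective (y : Equiv.Perm (Fin r)) : Function.Injective (flag y) := y⁻¹.injective

theorem partitionFunction_base (κ : WeightKind) (t : Rˣ) {μ : Fin r → ℤ} (hμ : Antitone μ)
    {M : ℤ} (hM : ∀ i, M ≤ μ i) (hn : ∀ i, μ i < M + n) (y : Equiv.Perm (Fin r)) :
    partitionFunction κ t μ (flag y) (flag y) M n = param r t ^ len y * zmon R μ := by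
  rw [partitionFunction_eq, rowsSum_frozen κ _ _ hμ hM hn (flag_injective y),
    ← len_eq_sum, mul_left_comm, ← Finset.prod_zpow, ← Finset.prod_mul_distrib, zmon]
  congr 1
  refine Finset.prod_congr rfl fun i _ => ?_
  rw [← zpow_natCast, ← zpow_add₀ (zvar_ne_zero i), Int.toNat_of_nonneg (sub_nonneg.2 (hM i)),
    add_sub_cancel]

theorem partitionFunction_eq_demLusWord (κ : WeightKind) (t : Rˣ) {μ : Fin r → ℤ}
    (hμ : Antitone μ) {M : ℤ} (hM : ∀ i, M ≤ μ i) (hn : ∀ i, μ i < M + n)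
    {w : Equiv.Perm (Fin r)} {l : List (Fin (r - 1))} (h : IsReducedWord w l) :
    partitionFunction κ t μ (flag 1) (flag w) M n = demLusWord t l (zmon R μ) := by
  induction l generalizing w with
  | nil =>
    have : w = 1 := by simpa using h.1.symm
    rw [this, partitionFunction_base κ t hμ hM hn, len_one, pow_zero, one_mul, demLusWord]
  | cons i l ih =>
    have := partitionFunction_up (R := R) κ t μ (flag 1) M n i (simpleRefl i * w)
      (by rw [simpleRefl_mul_cancel]; exact h.tail.2)
    rw [simpleRefl_mul_cancel, ih h.tail.1] at this
    exact this

theorem isTauFamily_partitionFunction (κ : WeightKind) (t : Rˣ) {μ : Fin r → ℤ}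
    (hμ : Antitone μ) {M : ℤ} (hM : ∀ i, M ≤ μ i) (hn : ∀ i, μ i < M + n)
    (y : Equiv.Perm (Fin r)) :
    IsTauFamily t μ y fun w => partitionFunction (R := R) κ t μ (flag y) (flag w) M n where
  mem_laurent _ := partitionFunction_mem_laurent κ t μ _ _ M n
  base := partitionFunction_base κ t hμ hM hn y
  up i w h := partitionFunction_up κ t μ _ M n i w h
  down i w h := partitionFunction_down κ t μ _ M n i w h

/-- Every `w` is reached from `y` by a word for `w * y⁻¹`, and each letter raises or lowers the
length, so one of the two recursions applies. The lengths along the way need not be monotone. -/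
theorem IsTauFamily.unique {t : Rˣ} {μ : Fin r → ℤ} {y : Equiv.Perm (Fin r)}
    {τ τ' : Equiv.Perm (Fin r) → RatField R r} (h : IsTauFamily t μ y τ)
    (h' : IsTauFamily t μ y τ') : τ' = τ := by
  have key : ∀ l : List (Fin (r - 1)),
      τ' ((l.map simpleRefl).prod * y) = τ ((l.map simpleRefl).prod * y) := by
    intro l
    induction l with
    | nil => simp [h.base, h'.base]
    | cons i l ih =>
      rw [List.map_cons, List.prod_cons, mul_assoc]
      generalize (l.map simpleRefl).prod * y = w at ih ⊢
      rcases inv_lo_lt_or_gt i w with hw | hw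
      · have := len_simpleRefl_mul_of_lt hw
        rw [h.up i w (by omega), h'.up i w (by omega), ih]
      · have := len_simpleRefl_mul_of_gt hw
        rw [h.down i w (by omega), h'.down i w (by omega), ih]
  funext w
  obtain ⟨l, hl, -⟩ := exists_isReducedWord (w * y⁻¹)
  have := key l
  rwa [hl, inv_mul_cancel_right] at this

end PartitionFunction

end ColoredBoson

open ColoredBoson in
theorem mainTheorem6 {R : Type*} [CommRing R] [IsDomain R] (t : Rˣ) (κ : WeightKind) {r : ℕ}
    (μ : Fin r → ℤ) (hμ : Antitone μ) (M : ℤ) (n : ℕ) (hM : ∀ i, M ≤ μ i)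
    (hn : ∀ i, μ i < M + n) :
    -- the sum over the states that defines each partition function is finite
    (∀ y w : Equiv.Perm (Fin r),
      {s : State μ (flag y) (flag w) M n | s.weight κ (param r t) (zvar R) ≠ 0}.Finite) ∧
    -- `Z(𝔖_{μ, 𝐜₀, w𝐜₀}) = 𝓛_{w,t} z^μ`, where `𝓛_{w,t}` is computed from any reduced word of `w`
    (∀ w : Equiv.Perm (Fin r), (∃ l, IsReducedWord w l) ∧ ∀ l, IsReducedWord w l →
      partitionFunction κ t μ (flag 1) (flag w) M n = demLusWord t l (zmon R μ)) ∧
    -- `Z(𝔖_{μ, y𝐜₀, w𝐜₀}) = τ^μ_{w,y}`, where `(τ^μ_{w,y})_w` is the unique family with its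
    -- characterizing properties
    (∀ y : Equiv.Perm (Fin r), ∃ τ : Equiv.Perm (Fin r) → RatField R r,
      IsTauFamily t μ y τ ∧ (∀ τ', IsTauFamily t μ y τ' → τ' = τ) ∧
      ∀ w, partitionFunction κ t μ (flag y) (flag w) M n = τ w) := by
  refine ⟨fun y w => State.finite_weight_ne_zero κ _ _,
    fun w => ⟨exists_isReducedWord w, fun l hl =>
      partitionFunction_eq_demLusWord κ t hμ hM hn hl⟩, fun y => ?_⟩
  have h := isTauFamily_partitionFunction (R := R) κ t hμ hM hn y
  exact ⟨_, h, fun τ' h' => h.unique h', fun w => rfl⟩
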